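/- **Setting.** Let $N$ be a finite set of buyers and $M$ a finite set of sellers, where seller $j$ can serve at most $k_j$ buyers. Buyer $i$ has values $v_{ij}\in[0,1]$, $j\in M$, and is served by at most one seller. Seller $j$ has a cost function $c_j:2^N\to\mathbb R$ with $c_j(\emptyset)=0$ that is *negative gross substitutes* (NGS): writing $D(p)=\arg\min_{S\subseteq N}\{c_j(S)-\sum_{i\in S}p_i\}$ for $p\in\mathbb R^N$, for all $q\le p$ in $\mathbb R^N$ and all $S\in D(p)$ there is $T\subseteq N$ with $(S\setminus A)\cup T\in D(q)$, where $A=\{i: q_i<p_i\}$ (equivalently, $-c_j$ satisfies the gross substitutes condition). The type of a buyer is her vector of values, the type of a seller is her cost function. Types are private and are drawn independently from commonly known discrete priors; $q_r$ is the probability of the type profile $r$. A (feasible) assignment $\sigma:N\to M\cup\{\text{none}\}$ gives each seller $j$ a set $S_j=\sigma^{-1}(j)$ with $|S_j|\le k_j$; its welfare is $\sum_i v_{i\sigma(i)}-\sum_j c_j(S_j)$, where the value of an unassigned buyer is $0$. The expected optimal welfare is assumed to be finite (this is automatic for nonnegative costs and for finitely supported priors). **Configuration LP.** For a type profile, maximize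 $\sum_{j}\sum_{|S|\le k_j}x_{jS}\big(\sum_{i\in S}v_{ij}-c_j(S)\big)$ subject to $\sum_S x_{jS}\le1$ for all $j\in M$, $\sum_j\sum_{S\ni i}x_{jS}\le 1$ for all $i\in N$, and $x\ge0$. The dual is to minimize $\sum_i y_i+\sum_j z_j$ subject to $\sum_{i\in S}y_i+z_j\ge\sum_{i\in S}v_{ij}-c_j(S)$ for all $j$ and all $|S|\le k_j$, and $y,z\ge0$. Let $W^*$ be the optimal value of the LP and $W$ the best value of an integral solution. The integrality gap $\alpha$ is the least $\alpha\ge1$ with $W^*\le\alpha W$ for all type profiles. **Mechanism 1.** *Allocation:* output a welfare-maximizing assignment for the reported types. *Pre-processing:* for every type profile $r$ choose an optimal dual solution and multiply it by $W/W^*$ to get utilities $(y^r,z^r)$; let $y_i=\sum_r q_ry_i^r$ and $z_j=\sum_r q_rz^r_j$. *Prices and wages:* in terms of the reported types and the chosen assignment, $$p_i=\sum_{j}c_j(S_j)-\sum_{i'\ne i}v_{i'\sigma(i')}+\sum_{i'\neq i}y_{i'}+\sum_jz_j,\qquad w_j=\sum_iv_{i\sigma(i)}-\sum_{j'\ne j}c_{j'}(S_{j'})-\sum_iy_i-\sum_{j'\ne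 j}z_{j'}.$$ The utility of buyer $i$ is $v_{i\sigma(i)}-p_i$ and that of seller $j$ is $w_j-c_j(S_j)$ (with true values and costs). **Corollary 3.** For every type profile the configuration LP has an integral optimal solution, so $\alpha=1$. Welfare-maximizing assignments and optimal dual solutions exist, and for every choice of them the utilities $(y^r,z^r)$ are nonnegative, sum up to the optimal welfare under $r$, and are such that no coalition of buyers and sellers can produce under $r$ a welfare larger than the sum of its utilities. Moreover, for all priors and all these choices, Mechanism 1 is * efficient: for every type profile the assignment maximizes welfare; * ex-ante budget balanced: under truthful reports, $\mathbb E\sum_ip_i=\mathbb E\sum_jw_j$; * DSIC: no agent can increase her utility by misreporting her type, whatever the reports of the others; * ex-ante IR: every agent has nonnegative expected utility under truthful reports; * ex-ante in the exact core: the expected utilities of all agents sum up to the expected welfare produced, and for every set of buyers and sellers the expectation of the maximum welfare that they can produce on their own is at most the sum of their expected utilities. All these expectations exist and are finite. -/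

import Mathlib

open Finset

noncomputable section

/-! ### Types of the agents: `N` is the set of buyers, `M` the set of sellers -/

/-- The bundles of buyers minimizing `c(S) - ∑_{i ∈ S} p_i`, i.e. the most profitable bundles for a
seller with cost function `c` when the prices charged to the buyers are `p`. -/
def NGSDemand {N : Type*} (c : Finset N → ℝ) (p : N → ℝ) : Set (Finset N) :=
  {S | ∀ T : Finset N, c S - ∑ i ∈ S, p i ≤ c T - ∑ i ∈ T, p i}

/-- Negative gross substitutes: when prices charged to some buyers decrease from `p` to `q`, the
demanded buyers whose price did not change can be kept. Prices range over all real vectors.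
Equivalently, `-c` satisfies the gross substitutes condition. -/
def IsNGS {N : Type*} [Fintype N] [DecidableEq N] (c : Finset N → ℝ) : Prop :=
  ∀ p q : N → ℝ, q ≤ p → ∀ S ∈ NGSDemand c p,
    ∃ T : Finset N, (S \ univ.filter (fun i => q i < p i)) ∪ T ∈ NGSDemand c q

/-- The type of a buyer: her values in `[0,1]` for being served by the various sellers. -/
def BuyerType (M : Type*) : Type _ :=
  {v : M → ℝ // ∀ j, v j ∈ Set.Icc (0 : ℝ) 1}

/-- The type of a seller: a negative gross substitutes cost function vanishing on the empty set. -/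
def SellerType (N : Type*) [Fintype N] [DecidableEq N] : Type _ :=
  {c : Finset N → ℝ // c ∅ = 0 ∧ IsNGS c}

/-- A profile (realization) of types of all buyers and all sellers. -/
abbrev Profile (N M : Type*) [Fintype N] [DecidableEq N] : Type _ :=
  (N → BuyerType M) × (M → SellerType N)

/-- Discrete prior distributions, one for each agent. -/
structure Prior (N M : Type*) [Fintype N] [DecidableEq N] where
  buyer : N → PMF (BuyerType M)
  seller : M → PMF (SellerType N)

/-- The probability of a realization: types are drawn independently. -/
def Prior.prob {N M : Type*} [Fintype N] [DecidableEq N] [Fintype M]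
    (P : Prior N M) (t : Profile N M) : ℝ :=
  (∏ i, (P.buyer i (t.1 i)).toReal) * ∏ j, (P.seller j (t.2 j)).toReal

/-- The expectation of `f` over the realizations exists and equals `e`. -/
def Prior.HasExp {N M : Type*} [Fintype N] [DecidableEq N] [Fintype M]
    (P : Prior N M) (f : Profile N M → ℝ) (e : ℝ) : Prop :=
  HasSum (fun t => P.prob t * f t) e

/-! ### Allocations and welfare -/

/-- The set of buyers served by seller `j`. -/
def served {N M : Type*} [Fintype N] [DecidableEq M] (σ : N → Option M) (j : M) : Finset N :=
  univ.filter (fun i => σ i = some j)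

/-- Assignments of the buyers to at most one seller each (`none` means unassigned), seller `j`
serving at most `k j` buyers. -/
def Allocation (N : Type*) {M : Type*} [Fintype N] [DecidableEq M] (k : M → ℕ) : Type _ :=
  {σ : N → Option M // ∀ j, (served σ j).card ≤ k j}

/-- The value of a buyer for her assignment; it is `0` when she is not served. -/
def BuyerType.value {M : Type*} (b : BuyerType M) (o : Option M) : ℝ :=
  o.elim 0 b.1

/-- Social welfare of an assignment: values of the matched buyers minus costs of the sellers. -/
def welfare {N M : Type*} [Fintype N] [Fintype M] [DecidableEq N] [DecidableEq M]
    (t : Profile N M) (σ : N → Option M) : ℝ :=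
  ∑ i, (t.1 i).value (σ i) - ∑ j, (t.2 j).1 (served σ j)

/-- The optimal welfare of the whole market (a maximum over a finite nonempty set). -/
def optWelfare {N M : Type*} [Fintype N] [Fintype M] [DecidableEq N] [DecidableEq M]
    (k : M → ℕ) (t : Profile N M) : ℝ :=
  ⨆ σ : Allocation N k, welfare t σ.1

/-- The largest welfare that the buyers in `A` and the sellers in `B` can produce on their own
(a maximum over a finite nonempty set; sellers outside `B` serve nobody and have cost `0`). -/
def coalitionWelfare {N M : Type*} [Fintype N] [Fintype M] [DecidableEq N] [DecidableEq M]
    (k : M → ℕ) (t : Profile N M) (A : Finset N) (B : Finset M) : ℝ :=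
  ⨆ σ : {σ : Allocation N k // ∀ i j, σ.1 i = some j → i ∈ A ∧ j ∈ B}, welfare t σ.1.1

/-- For the realization `t`, the utilities `y`, `z` are in the `α`-core: they sum up to the optimal
welfare and no coalition can produce more than `α` times the sum of its utilities. -/
def InCore {N M : Type*} [Fintype N] [Fintype M] [DecidableEq N] [DecidableEq M]
    (k : M → ℕ) (α : ℝ) (t : Profile N M) (y : N → ℝ) (z : M → ℝ) : Prop :=
  ∑ i, y i + ∑ j, z j = optWelfare k t ∧
  ∀ (A : Finset N) (B : Finset M),
    coalitionWelfare k t A B ≤ α * (∑ i ∈ A, y i + ∑ j ∈ B, z j)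

/-! ### The configuration linear program and its dual -/

/-- The welfare `∑_{i ∈ S} v_{ij} - c_j(S)` generated by seller `j` serving the set `S`. -/
def bundleWelfare {N M : Type*} [Fintype N] [DecidableEq N]
    (t : Profile N M) (j : M) (S : Finset N) : ℝ :=
  ∑ i ∈ S, (t.1 i).1 j - (t.2 j).1 S

/-- Feasible solutions of the configuration LP; there is a variable `x j S` for each seller `j` and
each `S` with at most `k j` elements (the other entries of `x` are `0`). -/
structure PrimalFeasible {N M : Type*} [Fintype N] [Fintype M] [DecidableEq N]
    (k : M → ℕ) (x : M → Finset N → ℝ) : Prop where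
  nonneg : ∀ j S, 0 ≤ x j S
  capacity : ∀ j S, k j < S.card → x j S = 0
  seller : ∀ j, ∑ S, x j S ≤ 1
  buyer : ∀ i, ∑ j, ∑ S ∈ univ.filter (fun S : Finset N => i ∈ S), x j S ≤ 1

/-- The objective of the configuration LP. -/
def primalValue {N M : Type*} [Fintype N] [Fintype M] [DecidableEq N]
    (t : Profile N M) (x : M → Finset N → ℝ) : ℝ :=
  ∑ j, ∑ S, x j S * bundleWelfare t j S

/-- Integral vectors. -/
def IsIntegralVec {N M : Type*} (x : M → Finset N → ℝ) : Prop :=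
  ∀ j S, ∃ a : ℤ, x j S = a

/-- The optimal value `W*` of the configuration LP (a supremum over a nonempty compact set). -/
def lpOpt {N M : Type*} [Fintype N] [Fintype M] [DecidableEq N]
    (k : M → ℕ) (t : Profile N M) : ℝ :=
  sSup {w | ∃ x, PrimalFeasible k x ∧ primalValue t x = w}

/-- The optimal value `W` among the integral solutions of the configuration LP. -/
def integralOpt {N M : Type*} [Fintype N] [Fintype M] [DecidableEq N]
    (k : M → ℕ) (t : Profile N M) : ℝ :=
  sSup {w | ∃ x, PrimalFeasible k x ∧ IsIntegralVec x ∧ primalValue t x = w}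

/-- The configuration LP is integral: an integral solution is optimal among all solutions. -/
def ConfigLPIntegral {N M : Type*} [Fintype N] [Fintype M] [DecidableEq N]
    (k : M → ℕ) (t : Profile N M) : Prop :=
  ∃ x, PrimalFeasible k x ∧ IsIntegralVec x ∧
    ∀ x', PrimalFeasible k x' → primalValue t x' ≤ primalValue t x

/-- `α` is the integrality gap of the configuration LP over all type profiles: the least factor
`α ≥ 1` such that `W* ≤ α W` always. -/
def IsIntegralityGap (N : Type*) {M : Type*} [Fintype N] [Fintype M] [DecidableEq N]
    (k : M → ℕ) (α : ℝ) : Prop :=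
  IsLeast {a : ℝ | 1 ≤ a ∧ ∀ t : Profile N M, lpOpt k t ≤ a * integralOpt k t} α

/-- Feasible solutions of the dual of the configuration LP. -/
structure DualFeasible {N M : Type*} [Fintype N] [DecidableEq N]
    (k : M → ℕ) (t : Profile N M) (y : N → ℝ) (z : M → ℝ) : Prop where
  cover : ∀ (j : M) (S : Finset N), S.card ≤ k j → bundleWelfare t j S ≤ ∑ i ∈ S, y i + z j
  buyer_nonneg : ∀ i, 0 ≤ y i
  seller_nonneg : ∀ j, 0 ≤ z j

/-- Optimal solutions of the dual of the configuration LP. -/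
def DualOptimal {N M : Type*} [Fintype N] [Fintype M] [DecidableEq N]
    (k : M → ℕ) (t : Profile N M) (y : N → ℝ) (z : M → ℝ) : Prop :=
  DualFeasible k t y z ∧
  ∀ y' z', DualFeasible k t y' z' → ∑ i, y i + ∑ j, z j ≤ ∑ i, y' i + ∑ j, z' j

/-! ### The two algorithms used by the mechanism -/

/-- A deterministic algorithm computing a welfare-maximizing assignment (any tie-breaking). -/
structure WelfareAlg (N : Type*) {M : Type*} [Fintype N] [Fintype M] [DecidableEq N]
    [DecidableEq M] (k : M → ℕ) where
  alloc : Profile N M → Allocation N k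
  optimal : ∀ t (σ : Allocation N k), welfare t σ.1 ≤ welfare t (alloc t).1

/-- A deterministic algorithm computing an optimal solution of the dual of the configuration LP. -/
structure CoreAlg (N : Type*) {M : Type*} [Fintype N] [Fintype M] [DecidableEq N]
    (k : M → ℕ) where
  dualY : Profile N M → N → ℝ
  dualZ : Profile N M → M → ℝ
  optimal : ∀ t, DualOptimal k t (dualY t) (dualZ t)

/-- The buyer utilities output: the dual variables scaled by `W / W*`. (If `W* = 0` then all the dual
variables are `0`, so the value of the quotient is irrelevant.) -/
def CoreAlg.y {N M : Type*} [Fintype N] [Fintype M] [DecidableEq N] {k : M → ℕ}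
    (C : CoreAlg N k) (t : Profile N M) (i : N) : ℝ :=
  C.dualY t i * (integralOpt k t / lpOpt k t)

/-- The seller utilities output: the dual variables scaled by `W / W*`. -/
def CoreAlg.z {N M : Type*} [Fintype N] [Fintype M] [DecidableEq N] {k : M → ℕ}
    (C : CoreAlg N k) (t : Profile N M) (j : M) : ℝ :=
  C.dualZ t j * (integralOpt k t / lpOpt k t)

/-! ### Mechanisms and their properties -/

/-- A direct mechanism: reported types are mapped to an assignment, prices and wages. -/
structure Mechanism (N : Type*) {M : Type*} [Fintype N] [DecidableEq N] [DecidableEq M]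
    (k : M → ℕ) where
  alloc : Profile N M → Allocation N k
  price : Profile N M → N → ℝ
  wage : Profile N M → M → ℝ

namespace Mechanism

variable {N M : Type*} [Fintype N] [Fintype M] [DecidableEq N] [DecidableEq M] {k : M → ℕ}

/-- Utility of buyer `i` with true type `b` when the reports are `r`. -/
def buyerUtility (m : Mechanism N k) (i : N) (b : BuyerType M) (r : Profile N M) : ℝ :=
  b.value ((m.alloc r).1 i) - m.price r i

/-- Utility of seller `j` with true type `c` when the reports are `r`. -/
def sellerUtility (m : Mechanism N k) (j : M) (c : SellerType N) (r : Profile N M) : ℝ :=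
  m.wage r j - c.1 (served (m.alloc r).1 j)

/-- The assignment maximizes social welfare. -/
def Efficient (m : Mechanism N k) : Prop :=
  ∀ t (σ : Allocation N k), welfare t σ.1 ≤ welfare t (m.alloc t).1

/-- No agent can gain by misreporting, whatever the other agents report. -/
def DSIC (m : Mechanism N k) : Prop :=
  (∀ (t : Profile N M) (i : N) (b : BuyerType M),
    m.buyerUtility i (t.1 i) (Function.update t.1 i b, t.2) ≤ m.buyerUtility i (t.1 i) t) ∧
  (∀ (t : Profile N M) (j : M) (c : SellerType N),
    m.sellerUtility j (t.2 j) (t.1, Function.update t.2 j c) ≤ m.sellerUtility j (t.2 j) t)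

/-- The expected sum of prices equals the expected sum of wages. -/
def ExAnteBB (m : Mechanism N k) (P : Prior N M) : Prop :=
  ∃ e : ℝ, P.HasExp (fun t => ∑ i, m.price t i) e ∧ P.HasExp (fun t => ∑ j, m.wage t j) e

/-- Every agent has nonnegative expected utility. -/
def ExAnteIR (m : Mechanism N k) (P : Prior N M) : Prop :=
  (∀ i, ∃ e : ℝ, 0 ≤ e ∧ P.HasExp (fun t => m.buyerUtility i (t.1 i) t) e) ∧
  (∀ j, ∃ e : ℝ, 0 ≤ e ∧ P.HasExp (fun t => m.sellerUtility j (t.2 j) t) e)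

/-- Ex-ante `α`-core: the expected utilities sum up to the expected welfare produced, and the
expected welfare that a coalition can produce is at most `α` times the sum of the expected
utilities of its members. -/
def ExAnteInCore (m : Mechanism N k) (P : Prior N M) (α : ℝ) : Prop :=
  ∃ (U : N → ℝ) (V : M → ℝ),
    (∀ i, P.HasExp (fun t => m.buyerUtility i (t.1 i) t) (U i)) ∧
    (∀ j, P.HasExp (fun t => m.sellerUtility j (t.2 j) t) (V j)) ∧
    P.HasExp (fun t => welfare t (m.alloc t).1) (∑ i, U i + ∑ j, V j) ∧
    ∀ (A : Finset N) (B : Finset M), ∃ e : ℝ,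
      P.HasExp (fun t => coalitionWelfare k t A B) e ∧
      e ≤ α * (∑ i ∈ A, U i + ∑ j ∈ B, V j)

end Mechanism

/-- The expected utility `y_i = ∑_r q_r y_i^r` of buyer `i` according to the core algorithm. -/
def CoreAlg.meanY {N M : Type*} [Fintype N] [Fintype M] [DecidableEq N] {k : M → ℕ}
    (C : CoreAlg N k) (P : Prior N M) (i : N) : ℝ :=
  ∑' r, P.prob r * C.y r i

/-- The expected utility `z_j = ∑_r q_r z_j^r` of seller `j` according to the core algorithm. -/
def CoreAlg.meanZ {N M : Type*} [Fintype N] [Fintype M] [DecidableEq N] {k : M → ℕ}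
    (C : CoreAlg N k) (P : Prior N M) (j : M) : ℝ :=
  ∑' r, P.prob r * C.z r j

/-- The VCG-type mechanism with prices and wages shifted by the expected core utilities. -/
def vcgCoreMechanism {N M : Type*} [Fintype N] [Fintype M] [DecidableEq N] [DecidableEq M]
    {k : M → ℕ} (P : Prior N M) (W : WelfareAlg N k) (C : CoreAlg N k) : Mechanism N k where
  alloc := W.alloc
  price r i :=
    ∑ j, (r.2 j).1 (served (W.alloc r).1 j)
      - ∑ i' ∈ univ.erase i, (r.1 i').value ((W.alloc r).1 i')
      + ∑ i' ∈ univ.erase i, C.meanY P i' + ∑ j, C.meanZ P j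
  wage r j :=
    ∑ i, (r.1 i).value ((W.alloc r).1 i)
      - ∑ j' ∈ univ.erase j, (r.2 j').1 (served (W.alloc r).1 j')
      - ∑ i, C.meanY P i - ∑ j' ∈ univ.erase j, C.meanZ P j'

end

/-! Read buyers as goods and sellers as bidders: `j` values a bundle `S` at `bundleWelfare t j S`.
Since `-c_j` is gross substitutes, so is this valuation, an additive term being harmless. A
Kelso–Crawford ascending auction with step `ε` then ends in an assignment and prices `p ≥ 0`, zero
on unassigned buyers, at which each seller holds a best bundle up to `ε` per buyer
(`exists_approx_equilibrium`). Setting `y = p + ε` and `z` equal to the profits gives a dual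
feasible point whose value exceeds the welfare of that assignment by at most `ε |N|`. Letting `ε →
0`, weak duality shows that the configuration LP is integral, and compactness gives an exact dual
optimum. Its constraints, summed over a coalition, are the core inequalities.

The delicate point is the capacity `k j`: gross substitutes must survive the restriction to bundles
of at most `k j` buyers. For this NGS is turned into inequalities on two and three elements
(`IsNGS.pair`, `IsNGS.triple`), which extend to the exchange property of valuated matroids
(`exchange_of_local`). Padding bundles with worthless dummies to size exactly `k` puts the capped
problem in that form (`LocalExchange.exchange`), and exchange gives gross substitutes back
(`LocalExchange.cappedDemand_raise`).

In the mechanism, an agent's utility is the true welfare of the chosen assignment plus a constant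
that depends only on the prior. This gives DSIC. The constants sum the core utilities in
expectation, so each agent's expected utility is exactly her expected core utility, and the ex-ante
claims follow by averaging the pointwise core. -/

/-! ### Negative gross substitutes imply local exchange inequalities -/

/-- Adding `L` inside `A` and `-L` outside `A ∪ Q`, a payment vector that forces the demanded
bundles to lie between `A` and `A ∪ Q`. -/
def forcingPayment {N : Type*} [DecidableEq N] (A Q : Finset N) (L : ℝ) (p : N → ℝ) (i : N) : ℝ :=
  if i ∈ A then L else if i ∈ Q then p i else -L

lemma exists_mem_ngsDemand {N : Type*} [Fintype N] [DecidableEq N] (c : Finset N → ℝ)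
    (p : N → ℝ) : ∃ S, S ∈ NGSDemand c p := by
  obtain ⟨S, -, hS⟩ := Finset.exists_min_image (univ : Finset (Finset N))
    (fun S => c S - ∑ i ∈ S, p i) ⟨∅, mem_univ _⟩
  exact ⟨S, fun T => hS T (mem_univ _)⟩

lemma ngsDemand_forcingPayment {N : Type*} [DecidableEq N]
    {c : Finset N → ℝ} {A Q : Finset N} {L : ℝ} (hL : ∀ S T, c S - c T < L)
    {p : N → ℝ} {S : Finset N} (hS : S ∈ NGSDemand c (forcingPayment A Q L p)) :
    A ⊆ S ∧ S ⊆ A ∪ Q := by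
  constructor
  · intro i hi
    by_contra h
    have h1 := hS (insert i S)
    rw [sum_insert h] at h1
    have h2 := hL (insert i S) S
    simp only [forcingPayment, hi, if_true] at h1
    linarith
  · intro i hi
    by_contra h
    rw [mem_union, not_or] at h
    have h1 := hS (S.erase i)
    rw [← add_sum_erase S _ hi] at h1
    have h2 := hL (S.erase i) S
    simp only [forcingPayment, h.1, h.2, if_false] at h1
    linarith

lemma sum_forcingPayment {N : Type*} [DecidableEq N] {A Q T : Finset N} (hAQ : Disjoint A Q)
    (hT : T ⊆ Q) (L : ℝ) (p : N → ℝ) :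
    ∑ i ∈ A ∪ T, forcingPayment A Q L p i = A.card * L + ∑ i ∈ T, p i := by
  rw [sum_union (hAQ.mono_right hT)]
  congr 1
  · rw [sum_congr rfl (g := fun _ => L) (fun i hi => by simp [forcingPayment, hi])]
    simp
  · refine sum_congr rfl fun i hi => ?_
    have : i ∉ A := fun h => disjoint_left.1 hAQ h (hT hi)
    simp [forcingPayment, this, hT hi]

/-- The gross substitutes condition for a decrease of one payment, on the interval of bundles
between `A` and `A ∪ Q`. -/
lemma IsNGS.interval {N : Type*} [Fintype N] [DecidableEq N] {c : Finset N → ℝ} (hc : IsNGS c)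
    {A Q : Finset N} (hAQ : Disjoint A Q) (p : N → ℝ) {S : Finset N} (hSQ : S ⊆ Q)
    (hS : ∀ T ⊆ Q, c (A ∪ S) - ∑ i ∈ S, p i ≤ c (A ∪ T) - ∑ i ∈ T, p i)
    {a : N} (ha : a ∈ Q) {q : N → ℝ} (hqa : q a ≤ p a) (hq : ∀ i, i ≠ a → q i = p i) :
    ∃ T ⊆ Q, S.erase a ⊆ T ∧
      ∀ T' ⊆ Q, c (A ∪ T) - ∑ i ∈ T, q i ≤ c (A ∪ T') - ∑ i ∈ T', q i := by
  obtain ⟨L, hL⟩ : ∃ L : ℝ, ∀ S T, c S - c T < L := by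
    refine ⟨2 * ∑ S, |c S| + 1, fun S T => ?_⟩
    have h1 := single_le_sum (f := fun S => |c S|) (fun i _ => abs_nonneg _) (mem_univ S)
    have h2 := single_le_sum (f := fun S => |c S|) (fun i _ => abs_nonneg _) (mem_univ T)
    have h3 := le_abs_self (c S)
    have h4 := neg_abs_le (c T)
    linarith
  -- Some global minimizer exists and must lie in the interval, so a minimizer within the interval
  -- is a global one.
  have key : A ∪ S ∈ NGSDemand c (forcingPayment A Q L p) := by
    obtain ⟨X, hX⟩ := exists_mem_ngsDemand c (forcingPayment A Q L p)
    obtain ⟨h1, h2⟩ := ngsDemand_forcingPayment hL hX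
    have hXe : X = A ∪ (X ∩ Q) := by grind
    intro Y
    refine le_trans ?_ (hX Y)
    rw [hXe, sum_forcingPayment hAQ hSQ, sum_forcingPayment hAQ inter_subset_right]
    linarith [hS (X ∩ Q) inter_subset_right]
  have haA : a ∉ A := fun h => disjoint_left.1 hAQ h ha
  have hsame : ∀ i, i ≠ a → forcingPayment A Q L q i = forcingPayment A Q L p i :=
    fun i hi => by unfold forcingPayment; rw [hq i hi]
  obtain ⟨T, hT⟩ := hc (forcingPayment A Q L p) (forcingPayment A Q L q) (by
    intro i
    by_cases hi : i = a
    · subst hi; simpa [forcingPayment, haA, ha] using hqa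
    · exact (hsame i hi).le) _ key
  set X := (A ∪ S) \ univ.filter
    (fun i => forcingPayment A Q L q i < forcingPayment A Q L p i) ∪ T with hXdef
  obtain ⟨h1, h2⟩ := ngsDemand_forcingPayment hL hT
  have hXe : X = A ∪ (X ∩ Q) := by grind
  refine ⟨X ∩ Q, inter_subset_right, ?_, ?_⟩
  · intro i hi
    obtain ⟨hia, hiS⟩ := mem_erase.1 hi
    refine mem_inter.2 ⟨?_, hSQ hiS⟩
    rw [hXdef]
    refine mem_union_left _ (mem_sdiff.2 ⟨mem_union_right _ hiS, ?_⟩)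
    simp [hsame i hia]
  · intro T' hT'
    have h3 := hT (A ∪ T')
    rw [hXe, sum_forcingPayment hAQ inter_subset_right, sum_forcingPayment hAQ hT'] at h3
    linarith

lemma subset_pair_cases {N : Type*} [DecidableEq N] {a b : N} {T : Finset N} (hT : T ⊆ {a, b}) :
    T = ∅ ∨ T = {a} ∨ T = {b} ∨ T = {a, b} := by
  by_cases h1 : a ∈ T <;> by_cases h2 : b ∈ T <;> grind

lemma subset_triple_cases {N : Type*} [DecidableEq N] {a b d : N} {T : Finset N}
    (hT : T ⊆ {a, b, d}) :
    T = ∅ ∨ T = {a} ∨ T = {b} ∨ T = {d} ∨ T = {a, b} ∨ T = {a, d} ∨ T = {b, d} ∨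
      T = {a, b, d} := by
  have h := subset_pair_cases (subset_insert_iff.1 hT)
  by_cases ha : a ∈ T
  · rw [← insert_erase ha]
    rcases h with h | h | h | h <;> rw [h] <;> simp
  · rw [erase_eq_of_notMem ha] at h
    rcases h with h | h | h | h <;> simp [h]

/-- Otherwise `a` and `b` are complements: at suitable payments `{a, b}` ties with `∅` while both
singletons are strictly worse. Lowering the payment of `a` must keep `b` demanded, yet `∅` now beats
every bundle containing `b`. -/
lemma IsNGS.pair {N : Type*} [Fintype N] [DecidableEq N] {c : Finset N → ℝ} (hc : IsNGS c)
    {A : Finset N} {a b : N} (ha : a ∉ A) (hb : b ∉ A) (hab : a ≠ b) :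
    c (insert a A) + c (insert b A) ≤ c (insert a (insert b A)) + c A := by
  by_contra! h
  -- The midpoint of the marginal costs of `a` over `A` and over `insert b A`; the payment of `b` is
  -- then fixed by the tie with `∅`.
  set x := (c (insert a A) - c A + (c (insert a (insert b A)) - c (insert b A))) / 2 with hx
  set p : N → ℝ := fun i => if i = a then x else c (insert a (insert b A)) - c A - x with hp
  have hpa : p a = x := by simp [hp]
  have hpb : p b = c (insert a (insert b A)) - c A - x := by simp [hp, hab.symm]
  have e0 : A ∪ (∅ : Finset N) = A := by simp
  have e1 : A ∪ ({a} : Finset N) = insert a A := by grind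
  have e2 : A ∪ ({b} : Finset N) = insert b A := by grind
  have e3 : A ∪ ({a, b} : Finset N) = insert a (insert b A) := by grind
  obtain ⟨T, hTQ, hbT, hT⟩ := hc.interval (A := A) (Q := {a, b}) (by simp [ha, hb]) p
    (S := {a, b}) subset_rfl (by
      intro T hT
      rcases subset_pair_cases hT with rfl | rfl | rfl | rfl <;>
        simp only [e0, e1, e2, e3, sum_pair hab, sum_singleton, sum_empty, hpa, hpb] <;> linarith)
    (a := a) (by simp) (q := Function.update p a (x - 1)) (by simp [hpa])
    (fun i hi => by simp [hi])
  have hqa : Function.update p a (x - 1) a = x - 1 := by simp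
  have hqb : Function.update p a (x - 1) b = c (insert a (insert b A)) - c A - x := by
    simp [hab.symm, hpb]
  have h0 := hT ∅ (by simp)
  have hbT' : b ∈ T := hbT (by simp [hab.symm])
  rcases subset_pair_cases hTQ with rfl | rfl | rfl | rfl <;>
    simp only [e0, e1, e2, e3, sum_pair hab, sum_singleton, sum_empty, hqa, hqb] at h0
  · simp at hbT'
  · simp [hab.symm] at hbT'
  · linarith
  · linarith

lemma exists_add_eq_of_lt {s m₁ m₂ n₁ n₂ : ℝ} (h₁ : m₁ + n₁ < s) (h₂ : m₁ + n₂ < s)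
    (h₃ : m₂ + n₁ < s) (h₄ : m₂ + n₂ < s) :
    ∃ x y : ℝ, x + y = s ∧ m₁ < x ∧ m₂ < x ∧ n₁ < y ∧ n₂ < y := by
  have h : max m₁ m₂ + max n₁ n₂ < s := by
    rcases max_choice m₁ m₂ with h | h <;> rcases max_choice n₁ n₂ with h' | h' <;>
      rw [h, h'] <;> assumption
  have := le_max_left m₁ m₂
  have := le_max_right m₁ m₂
  have := le_max_left n₁ n₂
  have := le_max_right n₁ n₂
  exact ⟨(s + max m₁ m₂ - max n₁ n₂) / 2, (s - max m₁ m₂ + max n₁ n₂) / 2,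
    by ring, by linarith, by linarith, by linarith, by linarith⟩

/-- If both alternatives fail, there are payments at which `{a, b}` and `{d}` tie and strictly beat
all other bundles. Lowering the payment of `a` leaves `{d}` as the only optimum, although `b` would
have to be kept. -/
lemma IsNGS.triple {N : Type*} [Fintype N] [DecidableEq N] {c : Finset N → ℝ} (hc : IsNGS c)
    {A : Finset N} {a b d : N} (ha : a ∉ A) (hb : b ∉ A) (hd : d ∉ A) (hab : a ≠ b)
    (had : a ≠ d) (hbd : b ≠ d) :
    c (insert a (insert d A)) + c (insert b A) ≤ c (insert a (insert b A)) + c (insert d A) ∨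
    c (insert b (insert d A)) + c (insert a A) ≤ c (insert a (insert b A)) + c (insert d A) := by
  by_contra! h
  obtain ⟨h1, h2⟩ := h
  have m1 := hc.pair ha hb hab
  have m2 := hc.pair ha hd had
  have m3 := hc.pair hb hd hbd
  have m4 := hc.pair (A := insert d A) (a := a) (b := b) (by grind) (by grind) hab
  have e0 : A ∪ (∅ : Finset N) = A := by simp
  have e1 : A ∪ ({a} : Finset N) = insert a A := by grind
  have e2 : A ∪ ({b} : Finset N) = insert b A := by grind
  have e3 : A ∪ ({d} : Finset N) = insert d A := by grind
  have e4 : A ∪ ({a, b} : Finset N) = insert a (insert b A) := by grind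
  have e5 : A ∪ ({a, d} : Finset N) = insert a (insert d A) := by grind
  have e6 : A ∪ ({b, d} : Finset N) = insert b (insert d A) := by grind
  have e7 : A ∪ ({a, b, d} : Finset N) = insert a (insert b (insert d A)) := by grind
  -- The common objective value of `{a, b}` and `{d}` will be `-v`. The lower bound makes `∅` worse
  -- and the upper one `{a, b, d}`; the interval is nonempty by the sum of `h1` and `h2`.
  obtain ⟨v, hv1, hv2⟩ : ∃ v, -c (insert a A) - c (insert b A) + c (insert a (insert b A)) < v ∧
      v < -c (insert a (insert b A)) - 2 * c (insert d A) + c (insert a (insert d A))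
        + c (insert b (insert d A)) := exists_between (by linarith)
  -- The bounds on `x` and `y` make `{a, d}`, `{a}`, `{b, d}` and `{b}`, in this order, strictly
  -- worse than `-v`.
  obtain ⟨x, y, hxy, hx1, hx2, hy1, hy2⟩ := exists_add_eq_of_lt
    (s := -c (insert a (insert b A)) - v)
    (m₁ := -c (insert a (insert d A)) + c (insert d A)) (m₂ := -c (insert a A) - v)
    (n₁ := -c (insert b (insert d A)) + c (insert d A)) (n₂ := -c (insert b A) - v)
    (by linarith) (by linarith) (by linarith) (by linarith)
  set p : N → ℝ := fun i => if i = a then -x else if i = b then -y else c (insert d A) + v with hp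
  have hpa : p a = -x := by simp [hp]
  have hpb : p b = -y := by simp [hp, hab.symm]
  have hpd : p d = c (insert d A) + v := by simp [hp, had.symm, hbd.symm]
  have hsum : ∀ f : N → ℝ, ∑ i ∈ ({a, b, d} : Finset N), f i = f a + (f b + f d) := by
    intro f
    rw [sum_insert (by simp [hab, had]), sum_pair hbd]
  obtain ⟨T, hTQ, hbT, hT⟩ := hc.interval (A := A) (Q := {a, b, d}) (by simp [ha, hb, hd]) p
    (S := {a, b}) (by grind) (by
      intro T hT
      rcases subset_triple_cases hT with rfl | rfl | rfl | rfl | rfl | rfl | rfl | rfl <;>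
        simp only [e0, e1, e2, e3, e4, e5, e6, e7, hsum, sum_pair hab, sum_pair had, sum_pair hbd,
          sum_singleton, sum_empty, hpa, hpb, hpd] <;> linarith)
    (a := a) (by simp) (q := Function.update p a (-x - 1)) (by simp [hpa])
    (fun i hi => by simp [hi])
  have hqa : Function.update p a (-x - 1) a = -x - 1 := by simp
  have hqb : Function.update p a (-x - 1) b = -y := by simp [hab.symm, hpb]
  have hqd : Function.update p a (-x - 1) d = c (insert d A) + v := by simp [had.symm, hpd]
  have h0 := hT {d} (by simp)
  have hbT' : b ∈ T := hbT (by simp [hab.symm])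
  rcases subset_triple_cases hTQ with rfl | rfl | rfl | rfl | rfl | rfl | rfl | rfl <;>
    simp only [e0, e1, e2, e3, e4, e5, e6, e7, hsum, sum_pair hab, sum_pair had, sum_pair hbd,
      sum_singleton, sum_empty, hqa, hqb, hqd] at h0
  · simp at hbT'
  · simp [hab.symm] at hbT'
  · linarith
  · simp [hbd] at hbT'
  · linarith
  · simp [hab.symm, hbd] at hbT'
  · linarith
  · linarith

/-- Local exchange properties of a set function, for two and three elements. -/
structure LocalExchange {N : Type*} [DecidableEq N] (u : Finset N → ℝ) : Prop where
  pair : ∀ (A : Finset N) (a b : N), a ∉ A → b ∉ A → a ≠ b →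
    u (insert a (insert b A)) + u A ≤ u (insert a A) + u (insert b A)
  triple : ∀ (A : Finset N) (a b d : N), a ∉ A → b ∉ A → d ∉ A → a ≠ b → a ≠ d → b ≠ d →
    u (insert a (insert b A)) + u (insert d A) ≤ u (insert a (insert d A)) + u (insert b A) ∨
    u (insert a (insert b A)) + u (insert d A) ≤ u (insert b (insert d A)) + u (insert a A)

lemma IsNGS.localExchange {N : Type*} [Fintype N] [DecidableEq N] {c : Finset N → ℝ}
    (hc : IsNGS c) (w : N → ℝ) : LocalExchange (fun S => ∑ i ∈ S, w i - c S) where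
  pair A a b ha hb hab := by
    have := hc.pair ha hb hab
    simp only [sum_insert ha, sum_insert hb, sum_insert (show a ∉ insert b A by simp [ha, hab])]
    linarith
  triple A a b d ha hb hd hab had hbd := by
    have := hc.triple ha hb hd hab had hbd
    simp only [sum_insert ha, sum_insert hb, sum_insert hd,
      sum_insert (show a ∉ insert b A by simp [ha, hab]),
      sum_insert (show a ∉ insert d A by simp [ha, had]),
      sum_insert (show b ∉ insert d A by simp [hb, hbd])]
    rcases this with h | h
    · left; linarith
    · right; linarith

/-! ### From local exchange to exchange under a capacity -/

/-- Apply the three-element inequality to `a, b` against `c` and `d`, and to `c, d` against `a` and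
`b`. For every choice of alternatives, two of the four inequalities, or all four, add up so that the
singleton terms cancel. -/
lemma LocalExchange.quad {N : Type*} [DecidableEq N] {u : Finset N → ℝ} (h : LocalExchange u)
    {A : Finset N} {a b c d : N} (ha : a ∉ A) (hb : b ∉ A) (hc : c ∉ A) (hd : d ∉ A)
    (hab : a ≠ b) (hac : a ≠ c) (had : a ≠ d) (hbc : b ≠ c) (hbd : b ≠ d) (hcd : c ≠ d) :
    u (insert a (insert b A)) + u (insert c (insert d A)) ≤
      u (insert a (insert c A)) + u (insert b (insert d A)) ∨
    u (insert a (insert b A)) + u (insert c (insert d A)) ≤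
      u (insert a (insert d A)) + u (insert b (insert c A)) := by
  have t1 := h.triple A a b c ha hb hc hab hac hbc
  have t2 := h.triple A a b d ha hb hd hab had hbd
  have t3 := h.triple A c d a hc hd ha hcd hac.symm had.symm
  have t4 := h.triple A c d b hc hd hb hcd hbc.symm hbd.symm
  rw [insert_comm c a, insert_comm d a] at t3
  rw [insert_comm c b, insert_comm d b] at t4
  by_contra! h'
  obtain ⟨p, q⟩ := h'
  rcases t1 with h1 | h1 <;> rcases t2 with h2 | h2 <;> rcases t3 with h3 | h3 <;>
    rcases t4 with h4 | h4 <;> linarith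

lemma insert_erase_eq_of_sdiff_eq {E : Type*} [DecidableEq E] {X Y : Finset E} {i j : E}
    (h : X \ Y = {i}) (h' : Y \ X = {j}) : insert j (X.erase i) = Y := by
  ext x
  have h1 := Finset.ext_iff.1 h x
  have h2 := Finset.ext_iff.1 h' x
  simp only [mem_sdiff, mem_singleton] at h1 h2
  simp only [mem_insert, mem_erase]
  tauto

/-- The exchange property of valuated matroids on a uniform matroid: it follows from its special
case for bases at distance two. -/
theorem exchange_of_local {E : Type*} [DecidableEq E] {ω : Finset E → ℝ} {r : ℕ}
    (hω : ∀ (A : Finset E) (a b c d : E), A.card + 2 = r → a ∉ A → b ∉ A → c ∉ A → d ∉ A →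
      a ≠ b → a ≠ c → a ≠ d → b ≠ c → b ≠ d → c ≠ d →
      ω (insert a (insert b A)) + ω (insert c (insert d A)) ≤
        ω (insert a (insert c A)) + ω (insert b (insert d A)) ∨
      ω (insert a (insert b A)) + ω (insert c (insert d A)) ≤
        ω (insert a (insert d A)) + ω (insert b (insert c A))) :
    ∀ (n : ℕ) (X Y : Finset E), X.card = r → Y.card = r → (X \ Y).card = n → ∀ i ∈ X \ Y,
      ∃ j ∈ Y \ X, ω X + ω Y ≤ ω (insert j (X.erase i)) + ω (insert i (Y.erase j)) := by
  intro n
  induction n with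
  | zero => intro X Y _ _ h i hi; rw [card_eq_zero] at h; simp [h] at hi
  | succ n ih =>
    intro X Y hX hY hn i hi
    have hYX : (Y \ X).card = n + 1 := by
      rw [← hn]; exact card_sdiff_comm (hY.trans hX.symm)
    by_contra! hbad
    have hne : ((X \ Y).erase i).Nonempty := by
      rw [nonempty_iff_ne_empty]
      intro h0
      -- At distance one the only exchange swaps `X` and `Y`, with equality.
      have hXY : X \ Y = {i} := by
        rw [← insert_erase hi, h0]; rfl
      have h1 : (Y \ X).card = 1 := by
        rw [hYX, ← hn, hXY, card_singleton]
      obtain ⟨j, hj⟩ := card_eq_one.1 h1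
      have e1 := insert_erase_eq_of_sdiff_eq hXY hj
      have e2 := insert_erase_eq_of_sdiff_eq hj hXY
      have := hbad j (by simp [hj])
      rw [e1, e2] at this
      linarith
    obtain ⟨a, ha⟩ := hne
    obtain ⟨hai, haXY⟩ := mem_erase.1 ha
    -- The pair `X`, `Y - b + a` is one step closer, so induction applies to it. Maximality of `b`
    -- will allow the `j` found there to be replaced by `b`.
    obtain ⟨b, hb, hbmax⟩ := exists_max_image (Y \ X)
      (fun j => ω (insert a (Y.erase j)) + ω (insert j (X.erase i)))
      (card_pos.1 (by omega))
    simp only [mem_sdiff] at hi haXY hb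
    obtain ⟨j, hj, hjle⟩ := ih X (insert a (Y.erase b)) hX
      (by rw [card_insert_of_notMem (by grind), card_erase_of_mem hb.1]
          have := card_pos.2 ⟨b, hb.1⟩
          omega)
      (by have : X \ insert a (Y.erase b) = (X \ Y).erase a := by grind
          rw [this, card_erase_of_mem (by grind), hn]; rfl)
      i (by grind)
    have hjY : j ∈ Y ∧ j ∉ X ∧ j ≠ b := by
      simp only [mem_sdiff, mem_insert, mem_erase] at hj
      rcases hj with ⟨rfl | h, h'⟩
      · exact absurd haXY.1 h'
      · exact ⟨h.2, h', h.1⟩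
    obtain ⟨hjY, hjX, hjb⟩ := hjY
    set A := (Y.erase b).erase j with hA
    have f1 : insert b (insert j A) = Y := by
      clear hω ih hbad hbmax hjle hj hYX hn; grind
    have f2 : insert i ((insert a (Y.erase b)).erase j) = insert a (insert i A) := by
      clear hω ih hbad hbmax hjle hj hYX hn; grind
    have f3 : insert b (insert a A) = insert a (Y.erase j) := by
      clear hω ih hbad hbmax hjle hj hYX hn; grind
    have f4 : insert j (insert i A) = insert i (Y.erase b) := by
      clear hω ih hbad hbmax hjle hj hYX hn; grind
    have f5 : insert b (insert i A) = insert i (Y.erase j) := by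
      clear hω ih hbad hbmax hjle hj hYX hn; grind
    have f6 : insert j (insert a A) = insert a (Y.erase b) := by
      clear hω ih hbad hbmax hjle hj hYX hn; grind
    have hAcard : A.card + 2 = r := by
      have h1 := card_erase_add_one (mem_erase.2 ⟨hjb, hjY⟩)
      have h2 := card_erase_add_one hb.1
      rw [← hA] at h1
      omega
    have hloc := hω A b j a i hAcard (by simp [hA]) (by simp [hA]) (by simp [hA, haXY.2])
      (by simp [hA, hi.2]) hjb.symm (ne_of_mem_of_not_mem hb.1 haXY.2)
      (ne_of_mem_of_not_mem hb.1 hi.2) (ne_of_mem_of_not_mem hjY haXY.2)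
      (ne_of_mem_of_not_mem hjY hi.2) hai
    rw [f1, f3, f4, f5, f6, ← f2] at hloc
    have g1 := hbmax j (by simp [hjY, hjX])
    have g2 := hbad j (by simp [hjY, hjX])
    have g3 := hbad b (by simp [hb])
    -- Add `hloc` to `hjle`. The first alternative, with the maximality of `b`, makes `b` a valid
    -- exchange; the second makes `j` one.
    rcases hloc with h | h <;> linarith

/-- The elements of `D` are worthless dummies. According to how many of the four elements are
dummies, the claim is the four-, three- or two-element inequality, or trivial. -/
lemma LocalExchange.sum {N : Type*} [DecidableEq N] {u : Finset N → ℝ} (h : LocalExchange u)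
    {D : Type*} [DecidableEq D] (A : Finset (N ⊕ D)) (a b c d : N ⊕ D)
    (ha : a ∉ A) (hb : b ∉ A) (hc : c ∉ A) (hd : d ∉ A)
    (hab : a ≠ b) (hac : a ≠ c) (had : a ≠ d) (hbc : b ≠ c) (hbd : b ≠ d) (hcd : c ≠ d) :
    u (insert a (insert b A)).toLeft + u (insert c (insert d A)).toLeft ≤
      u (insert a (insert c A)).toLeft + u (insert b (insert d A)).toLeft ∨
    u (insert a (insert b A)).toLeft + u (insert c (insert d A)).toLeft ≤
      u (insert a (insert d A)).toLeft + u (insert b (insert c A)).toLeft := by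
  have hmem : ∀ x : N, Sum.inl x ∉ A → x ∉ A.toLeft := fun x hx => by simpa using hx
  rcases a with a | a <;> rcases b with b | b <;> rcases c with c | c <;> rcases d with d | d <;>
    simp only [toLeft_insert_inl, toLeft_insert_inr, ne_eq, Sum.inl.injEq] at *
  · exact h.quad (hmem _ ha) (hmem _ hb) (hmem _ hc) (hmem _ hd) hab hac had hbc hbd hcd
  · exact (h.triple _ a b c (hmem _ ha) (hmem _ hb) (hmem _ hc) hab hac hbc).imp id
      (fun h => by linarith)
  · exact (h.triple _ a b d (hmem _ ha) (hmem _ hb) (hmem _ hd) hab had hbd).symm.imp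
      (fun h => by linarith) id
  · exact Or.inl (h.pair _ a b (hmem _ ha) (hmem _ hb) hab)
  · have := h.triple _ c d a (hmem _ hc) (hmem _ hd) (hmem _ ha) hcd (Ne.symm hac) (Ne.symm had)
    rw [insert_comm c a, insert_comm d a] at this
    exact this.imp (fun h => by linarith) (fun h => by linarith)
  · exact Or.inr le_rfl
  · exact Or.inl le_rfl
  · exact Or.inl le_rfl
  · have := h.triple _ c d b (hmem _ hc) (hmem _ hd) (hmem _ hb) hcd (Ne.symm hbc) (Ne.symm hbd)
    rw [insert_comm c b, insert_comm d b] at this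
    exact this.symm.imp (fun h => by linarith) (fun h => by linarith)
  · exact Or.inl (add_comm _ _).le
  · exact Or.inr (add_comm _ _).le
  · exact Or.inl (add_comm _ _).le
  · exact Or.inl (by linarith [h.pair _ c d (hmem _ hc) (hmem _ hd) hcd])
  · exact Or.inl (add_comm _ _).le
  · exact Or.inl le_rfl
  · exact Or.inl le_rfl

/-- The exchange property of M♮-concave functions, restricted to bundles of at most `k`
elements. -/
theorem LocalExchange.exchange {N : Type*} [DecidableEq N] {u : Finset N → ℝ}
    (h : LocalExchange u) {k : ℕ} {S T : Finset N} (hS : S.card ≤ k) (hT : T.card ≤ k)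
    {i : N} (hi : i ∈ S) (hiT : i ∉ T) :
    (T.card < k ∧ u S + u T ≤ u (S.erase i) + u (insert i T)) ∨
    ∃ j ∈ T, j ∉ S ∧ u S + u T ≤ u (insert j (S.erase i)) + u (insert i (T.erase j)) := by
  have hcard : ∀ m ≤ k, (univ.filter (fun x : Fin k => x.1 < m)).card = m := by
    intro m hm
    rw [Fin.card_filter_val_lt, min_eq_right hm]
  -- Every admissible bundle is padded to exactly `k` elements by an initial segment of `k` dummies.
  have hdisj : ∀ U : Finset N, U.card ≤ k →
      (U.disjSum (univ.filter (fun x : Fin k => x.1 < k - U.card))).card = k := by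
    intro U hU
    rw [card_disjSum, hcard _ (by omega)]
    omega
  obtain ⟨j, hj, hle⟩ := exchange_of_local (ω := fun X : Finset (N ⊕ Fin k) => u X.toLeft) (r := k)
    (fun A a b c d _ => h.sum A a b c d) _ _ _ (hdisj S hS) (hdisj T hT) rfl (Sum.inl i)
    (by simp [hi, hiT])
  rw [mem_sdiff] at hj
  have el : ∀ (X : Finset (N ⊕ Fin k)) (x : N), (X.erase (Sum.inl x)).toLeft = X.toLeft.erase x := by
    intro X x; ext; simp
  have er : ∀ (X : Finset (N ⊕ Fin k)) (x : Fin k), (X.erase (Sum.inr x)).toLeft = X.toLeft := by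
    intro X x; ext; simp
  rcases j with j | j
  · right
    refine ⟨j, by simpa using hj.1, by simpa using hj.2, ?_⟩
    simpa [el, er, toLeft_insert_inl] using hle
  · left
    refine ⟨?_, by simpa [el, er, toLeft_insert_inl, toLeft_insert_inr] using hle⟩
    -- A dummy given up by the padded `T` means that `T` had room left.
    have := hj.1
    simp only [inr_mem_disjSum, mem_filter, mem_univ, true_and] at this
    omega

/-! ### Gross substitutes for capped demand -/

/-- The bundles of at most `k` elements maximizing `u(S) - ∑_{i ∈ S} p_i`. -/
def cappedDemand {N : Type*} (u : Finset N → ℝ) (k : ℕ) (p : N → ℝ) : Set (Finset N) :=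
  {S | S.card ≤ k ∧ ∀ T : Finset N, T.card ≤ k → u T - ∑ i ∈ T, p i ≤ u S - ∑ i ∈ S, p i}

lemma exists_mem_cappedDemand {N : Type*} [Fintype N] (u : Finset N → ℝ) (k : ℕ)
    (p : N → ℝ) : ∃ S, S ∈ cappedDemand u k p := by
  obtain ⟨S, hS, hmax⟩ := exists_max_image ((univ : Finset (Finset N)).filter (·.card ≤ k))
    (fun S => u S - ∑ i ∈ S, p i) ⟨∅, by simp⟩
  exact ⟨S, (mem_filter.1 hS).2, fun T hT => hmax T (by simp [hT])⟩

lemma LocalExchange.cappedDemand_raise_one {N : Type*} [Fintype N] [DecidableEq N]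
    {u : Finset N → ℝ} (h : LocalExchange u) {k : ℕ} {p q : N → ℝ} {a : N} (hpq : p a ≤ q a)
    (heq : ∀ i, i ≠ a → q i = p i) {S : Finset N} (hS : S ∈ cappedDemand u k p) :
    ∃ T ∈ cappedDemand u k q, S.erase a ⊆ T := by
  have hle : p ≤ q := fun i => by
    by_cases hi : i = a
    · exact hi ▸ hpq
    · exact (heq i hi).ge
  have hout : ∀ X : Finset N, a ∉ X → ∑ i ∈ X, q i = ∑ i ∈ X, p i := fun X hX =>
    sum_congr rfl fun i hi => heq i (ne_of_mem_of_not_mem hi hX)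
  have hin : ∀ X : Finset N, a ∈ X → ∑ i ∈ X, q i = ∑ i ∈ X, p i + (q a - p a) := by
    intro X hX
    rw [← add_sum_erase X q hX, ← add_sum_erase X p hX, hout _ (notMem_erase a X)]
    ring
  by_cases hSq : S ∈ cappedDemand u k q
  · exact ⟨S, hSq, erase_subset _ _⟩
  have haS : a ∈ S := by
    by_contra haS
    refine hSq ⟨hS.1, fun T hT => ?_⟩
    rw [hout S haS]
    linarith [hS.2 T hT, sum_le_sum (s := T) fun i _ => hle i]
  classical
  obtain ⟨T₀, hT₀⟩ := exists_mem_cappedDemand u k q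
  -- Among the optima at `q`, take one that misses as little of `S.erase a` as possible. A missing
  -- `i` could be exchanged in from `S`: optimality of `S` at `p` makes the exchange lossless for
  -- `T`, since `a` is not involved and other prices agree.
  obtain ⟨T, hT, hmin⟩ := exists_min_image (univ.filter (· ∈ cappedDemand u k q))
    (fun T => (S.erase a \ T).card) ⟨T₀, by simp [hT₀]⟩
  simp only [mem_filter, mem_univ, true_and] at hT hmin
  refine ⟨T, hT, ?_⟩
  by_contra hnot
  obtain ⟨i, hi, hiT⟩ := not_subset.1 hnot
  obtain ⟨hia, hiS⟩ := mem_erase.1 hi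
  -- If `T` contained `a`, the rise would cost `S` and `T` the same, and `S` would remain optimal.
  have haT : a ∉ T := by
    intro haT
    refine hSq ⟨hS.1, fun X hX => (hT.2 X hX).trans ?_⟩
    rw [hin S haS, hin T haT]
    linarith [hS.2 T hT.1]
  have hcontra : ∀ T', T' ∈ cappedDemand u k q → i ∈ T' → S.erase a ∩ T ⊆ T' → False := by
    intro T' hT' hi' hsub
    refine absurd (hmin T' hT') (not_le.2 (card_lt_card ⟨?_, fun hss => ?_⟩))
    · intro x hx
      simp only [mem_sdiff] at hx ⊢
      exact ⟨hx.1, fun hxT => hx.2 (hsub (mem_inter.2 ⟨hx.1, hxT⟩))⟩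
    · exact (mem_sdiff.1 (hss (mem_sdiff.2 ⟨hi, hiT⟩))).2 hi'
  rcases h.exchange hS.1 hT.1 hiS hiT with ⟨hlt, hle'⟩ | ⟨j, hjT, hjS, hle'⟩
  · refine hcontra (insert i T) ⟨by rw [card_insert_of_notMem hiT]; omega, fun X hX => ?_⟩
      (mem_insert_self _ _) (fun x hx => mem_insert_of_mem (mem_inter.1 hx).2)
    refine (hT.2 X hX).trans ?_
    have h1 := hS.2 (S.erase i) ((card_erase_le).trans hS.1)
    rw [← add_sum_erase S p hiS] at h1
    rw [sum_insert hiT, heq i hia]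
    linarith
  · have hja : j ≠ a := (ne_of_mem_of_not_mem haS hjS).symm
    have hj1 : j ∉ S.erase i := fun hh => hjS (mem_of_mem_erase hh)
    have hi1 : i ∉ T.erase j := fun hh => hiT (mem_of_mem_erase hh)
    refine hcontra (insert i (T.erase j)) ⟨?_, fun X hX => ?_⟩
      (mem_insert_self _ _) (fun x hx => ?_)
    · rw [card_insert_of_notMem hi1, card_erase_add_one hjT]
      exact hT.1
    · refine (hT.2 X hX).trans ?_
      have h1 := hS.2 (insert j (S.erase i)) (by
        rw [card_insert_of_notMem hj1, card_erase_add_one hiS]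
        exact hS.1)
      rw [← add_sum_erase S p hiS, sum_insert hj1] at h1
      rw [sum_insert hi1, ← add_sum_erase T q hjT, heq i hia, heq j hja]
      linarith
    · have hx' := mem_inter.1 hx
      refine mem_insert_of_mem (mem_erase.2 ⟨?_, hx'.2⟩)
      exact ne_of_mem_of_not_mem (mem_of_mem_erase hx'.1) hjS

/-- Gross substitutes for the valuation restricted to bundles of at most `k` elements. -/
lemma LocalExchange.cappedDemand_raise {N : Type*} [Fintype N] [DecidableEq N]
    {u : Finset N → ℝ} (h : LocalExchange u) {k : ℕ} {p q : N → ℝ} (hpq : p ≤ q)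
    {S : Finset N} (hS : S ∈ cappedDemand u k p) :
    ∃ T ∈ cappedDemand u k q, ∀ i ∈ S, q i = p i → i ∈ T := by
  -- The prices are raised one at a time, over a growing set `F`.
  have key : ∀ F : Finset N, ∃ T ∈ cappedDemand u k (fun i => if i ∈ F then q i else p i),
      S \ F ⊆ T := by
    intro F
    induction F using Finset.induction_on with
    | empty => exact ⟨S, by simpa using hS, by simp⟩
    | insert a F ha ih =>
      obtain ⟨T, hT, hsub⟩ := ih
      obtain ⟨T', hT', hsub'⟩ := h.cappedDemand_raise_one (a := a)
        (q := fun i => if i ∈ insert a F then q i else p i) (by simpa [ha] using hpq a)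
        (fun i hi => by simp [hi]) hT
      refine ⟨T', hT', fun x hx => hsub' ?_⟩
      simp only [mem_sdiff, mem_insert, not_or] at hx
      exact mem_erase.2 ⟨hx.2.1, hsub (mem_sdiff.2 ⟨hx.1, hx.2.2⟩)⟩
  classical
  obtain ⟨T, hT, hsub⟩ := key (univ.filter fun i => q i ≠ p i)
  refine ⟨T, ?_, fun i hi hqp => hsub (by simp [hi, hqp])⟩
  convert hT using 2 with i
  funext i
  by_cases hi : q i = p i <;> simp [hi]

/-! ### The ascending auction -/

/-- A state of the ascending auction with step `ε`: buyers marked `σ i = some j` are provisionally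
held by `j`, who faces price `ε * n i` for them and `ε * (n i + 1)` for all others. -/
structure AuctionState {N M : Type*} [Fintype N] [DecidableEq M] (u : M → Finset N → ℝ)
    (k : M → ℕ) (ε : ℝ) (B : ℕ) (n : N → ℕ) (σ : N → Option M) : Prop where
  unheld : ∀ i, σ i = none → n i = 0
  bounded : ∀ i, n i ≤ B
  demand : ∀ j, ∃ D ∈ cappedDemand (u j) (k j)
    (fun i => ε * (n i + if σ i = some j then 0 else 1)), served σ j ⊆ D

lemma mem_served {N M : Type*} [Fintype N] [DecidableEq M] {σ : N → Option M} {j : M} {i : N} :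
    i ∈ served σ j ↔ σ i = some j := by simp [served]

/-- As long as some `j` does not demand exactly what she holds, the auction can proceed. -/
lemma AuctionState.step {N M : Type*} [Fintype N] [DecidableEq N] [DecidableEq M]
    {u : M → Finset N → ℝ} {k : M → ℕ} {ε : ℝ} {B : ℕ} {n : N → ℕ} {σ : N → Option M}
    (hu : ∀ j, LocalExchange (u j)) (hε : 0 < ε) (hB : ∀ j S T, u j S - u j T ≤ ε * B)
    (h : AuctionState u k ε B n σ) {j : M} {D : Finset N}
    (hD : D ∈ cappedDemand (u j) (k j) (fun i => ε * (n i + if σ i = some j then 0 else 1)))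
    (hsub : served σ j ⊆ D) (hne : D ≠ served σ j) :
    ∃ n' σ', AuctionState u k ε B n' σ' ∧ ∑ i, n i < ∑ i, n' i := by
  have hsub' : ∀ i, σ i = some j → i ∈ D := fun i hi => hsub (mem_served.2 hi)
  -- Bidder `j` takes all of `D`, and each newly acquired buyer rises by one step.
  refine ⟨fun i => n i + if i ∈ D ∧ σ i ≠ some j then 1 else 0,
    fun i => if i ∈ D then some j else σ i, ⟨?_, ?_, ?_⟩, ?_⟩
  · intro i hi
    by_cases hiD : i ∈ D
    · simp [hiD] at hi
    · simp only [hiD, if_false] at hi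
      simp [hiD, h.unheld i hi]
  · intro i
    by_cases hi : i ∈ D ∧ σ i ≠ some j
    · simp only [hi, ne_eq, not_false_eq_true, and_self, if_true]
      -- Dropping `i` from `D` does not help `j`, so the price paid for `i` is at most a marginal
      -- value, hence at most `ε * B`.
      have h1 := hD.2 (D.erase i) (card_erase_le.trans hD.1)
      rw [← add_sum_erase D _ hi.1] at h1
      simp only [hi.2, if_false] at h1
      have h2 : ε * ((n i : ℝ) + 1) ≤ ε * B := by linarith [hB j D (D.erase i)]
      have h3 := le_of_mul_le_mul_left h2 hε
      exact_mod_cast h3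
    · simp only [hi, if_false, add_zero]
      exact h.bounded i
  · intro l
    by_cases hl : l = j
    · subst hl
      refine ⟨D, ?_, fun i hi => ?_⟩
      -- The prices faced by `j` do not change: a buyer just taken costs one step more but loses the
      -- surcharge.
      · convert hD using 2
        funext i
        by_cases hiD : i ∈ D
        · by_cases hij : σ i = some l <;> simp [hiD, hij]
        · have hij : σ i ≠ some l := fun h' => hiD (hsub' i h')
          simp [hiD, hij]
      · by_contra hiD
        rw [mem_served] at hi
        simp only [hiD, if_false] at hi
        exact hiD (hsub' i hi)
    · obtain ⟨E, hE, hEs⟩ := h.demand l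
      have hjl : j ≠ l := Ne.symm hl
      -- For `l ≠ j` prices only rise, and those of the buyers she still holds stay put, so gross
      -- substitutes keep these demanded.
      obtain ⟨T, hT, hTs⟩ := (hu l).cappedDemand_raise (q := fun i =>
        ε * (((n i + if i ∈ D ∧ σ i ≠ some j then 1 else 0 : ℕ) : ℝ) +
          if (if i ∈ D then some j else σ i) = some l then 0 else 1)) (by
        intro i
        refine mul_le_mul_of_nonneg_left ?_ hε.le
        by_cases hiD : i ∈ D
        · by_cases hij : σ i = some j <;> by_cases hil : σ i = some l <;>
            simp [hiD, hij, hil, hjl, hl]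
          linarith
        · simp [hiD]) hE
      refine ⟨T, hT, fun i hi => ?_⟩
      rw [mem_served] at hi
      by_cases hiD : i ∈ D
      · simp [hiD, hjl] at hi
      · simp only [hiD, if_false] at hi
        exact hTs i (hEs (mem_served.2 hi)) (by simp [hiD])
  · obtain ⟨i, hiD, hi⟩ := exists_of_ssubset (hsub.ssubset_of_ne hne.symm)
    rw [mem_served] at hi
    exact sum_lt_sum (fun i _ => Nat.le_add_right _ _) ⟨i, mem_univ i, by simp [hiD, hi]⟩

/-- The ascending auction of Kelso and Crawford ends in an approximate equilibrium. -/
theorem exists_approx_equilibrium {N M : Type*} [Fintype N] [Fintype M] [DecidableEq N]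
    [DecidableEq M] {u : M → Finset N → ℝ} (hu : ∀ j, LocalExchange (u j)) (k : M → ℕ)
    {ε : ℝ} (hε : 0 < ε) :
    ∃ (σ : N → Option M) (p : N → ℝ), (∀ j, (served σ j).card ≤ k j) ∧ (∀ i, 0 ≤ p i) ∧
      (∀ i, σ i = none → p i = 0) ∧
      ∀ j (S : Finset N), S.card ≤ k j →
        u j S - ∑ i ∈ S, (p i + ε) ≤ u j (served σ j) - ∑ i ∈ served σ j, p i := by
  obtain ⟨B, hB⟩ : ∃ B : ℕ, ∀ j S T, u j S - u j T ≤ ε * B := by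
    obtain ⟨B, hB⟩ := exists_nat_ge ((2 * ∑ j, ∑ S, |u j S|) / ε)
    refine ⟨B, fun j S T => ?_⟩
    rw [div_le_iff₀ hε] at hB
    have h0 : ∀ S, |u j S| ≤ ∑ j, ∑ S, |u j S| := fun S =>
      (single_le_sum (f := fun S => |u j S|) (fun i _ => abs_nonneg _) (mem_univ S)).trans
      (single_le_sum (f := fun j => ∑ S, |u j S|)
        (fun i _ => sum_nonneg fun _ _ => abs_nonneg _) (mem_univ j))
    linarith [h0 S, h0 T, le_abs_self (u j S), neg_abs_le (u j T)]
  set P : ℕ → Prop := fun m => ∃ n σ, AuctionState u k ε B n σ ∧ ∑ i, n i = m with hP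
  have hP0 : P 0 := ⟨fun _ => 0, fun _ => none, ⟨fun _ _ => rfl, fun _ => Nat.zero_le _, fun j => by
    obtain ⟨D, hD⟩ := exists_mem_cappedDemand (u j) (k j)
      (fun _ => ε * (((0 : ℕ) : ℝ) + if (none : Option M) = some j then 0 else 1))
    exact ⟨D, hD, by simp [served]⟩⟩, by simp⟩
  have hPb : ∀ m, P m → m ≤ Fintype.card N * B := by
    rintro m ⟨n, σ, h, rfl⟩
    exact (sum_le_card_nsmul _ _ B fun i _ => h.bounded i).trans (by simp)
  classical
  -- In a state of largest total price no step is possible, so each bidder demands exactly what she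
  -- holds.
  obtain ⟨n, σ, hst, hsum⟩ := Nat.findGreatest_spec (P := P) (Nat.zero_le (Fintype.card N * B)) hP0
  have hdem : ∀ j, served σ j ∈ cappedDemand (u j) (k j)
      (fun i => ε * (n i + if σ i = some j then 0 else 1)) := by
    intro j
    obtain ⟨D, hD, hsub⟩ := hst.demand j
    by_cases hne : D = served σ j
    · exact hne ▸ hD
    · exfalso
      obtain ⟨n', σ', h', hlt⟩ := hst.step hu hε hB hD hsub hne
      have hP' : P (∑ i, n' i) := ⟨n', σ', h', rfl⟩
      have := Nat.le_findGreatest (hPb _ hP') hP'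
      omega
  refine ⟨σ, fun i => ε * n i, fun j => (hdem j).1, fun i => by positivity,
    fun i hi => by simp [hst.unheld i hi], fun j S hS => ?_⟩
  have h1 := (hdem j).2 S hS
  have h2 : ∑ i ∈ served σ j, ε * ((n i : ℝ) + if σ i = some j then 0 else 1) =
      ∑ i ∈ served σ j, ε * (n i : ℝ) :=
    sum_congr rfl fun i hi => by simp [mem_served.1 hi]
  have h3 : ∑ i ∈ S, ε * ((n i : ℝ) + if σ i = some j then 0 else 1) ≤
      ∑ i ∈ S, (ε * (n i : ℝ) + ε) :=
    sum_le_sum fun i _ => by split_ifs <;> nlinarith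
  linarith

/-! ### Duality and integrality of the configuration LP -/

lemma sum_sum_served {N M : Type*} [Fintype N] [Fintype M] [DecidableEq M]
    (σ : N → Option M) (f : N → M → ℝ) :
    ∑ j, ∑ i ∈ served σ j, f i j = ∑ i, (σ i).elim 0 (f i) := by
  simp only [served, sum_filter]
  rw [sum_comm]
  refine sum_congr rfl fun i _ => ?_
  cases σ i <;> simp

lemma sum_sum_served_of_none {N M : Type*} [Fintype N] [Fintype M] [DecidableEq M]
    {σ : N → Option M} {f : N → ℝ} (hf : ∀ i, σ i = none → f i = 0) :
    ∑ j, ∑ i ∈ served σ j, f i = ∑ i, f i := by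
  rw [sum_sum_served σ fun i _ => f i]
  refine sum_congr rfl fun i _ => ?_
  cases h : σ i
  · simp [hf i h]
  · rfl

lemma sum_sum_served_le {N M : Type*} [Fintype N] [Fintype M] [DecidableEq M]
    {σ : N → Option M} {f : N → ℝ} (hf : ∀ i, 0 ≤ f i) {A : Finset N}
    (hA : ∀ i j, σ i = some j → i ∈ A) :
    ∑ j, ∑ i ∈ served σ j, f i ≤ ∑ i ∈ A, f i := by
  rw [sum_sum_served σ fun i _ => f i, ← sum_subset (subset_univ A)]
  · refine sum_le_sum fun i _ => ?_
    cases h : σ i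
    · exact hf i
    · exact le_rfl
  · intro i _ hi
    cases h : σ i with
    | none => rfl
    | some j => exact absurd (hA i j h) hi

lemma bundleWelfare_empty {N M : Type*} [Fintype N] [DecidableEq N] (t : Profile N M) (j : M) :
    bundleWelfare t j ∅ = 0 := by
  simp [bundleWelfare, (t.2 j).2.1]

lemma localExchange_bundleWelfare {N M : Type*} [Fintype N] [DecidableEq N]
    (t : Profile N M) (j : M) :
    LocalExchange (bundleWelfare t j) :=
  (t.2 j).2.2.localExchange fun i => (t.1 i).1 j

/-- Weak duality: weight the covering constraints by `x` and exchange the order of summation. -/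
lemma PrimalFeasible.primalValue_le {N M : Type*} [Fintype N] [Fintype M] [DecidableEq N]
    {k : M → ℕ} {t : Profile N M} {x : M → Finset N → ℝ}
    (hx : PrimalFeasible k x) {y : N → ℝ} {z : M → ℝ} (h : DualFeasible k t y z) :
    primalValue t x ≤ ∑ i, y i + ∑ j, z j := by
  have h1 : primalValue t x ≤ ∑ j, ∑ S, x j S * (∑ i ∈ S, y i + z j) := by
    refine sum_le_sum fun j _ => sum_le_sum fun S _ => ?_
    by_cases hS : S.card ≤ k j
    · exact mul_le_mul_of_nonneg_left (h.cover j S hS) (hx.nonneg j S)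
    · simp [hx.capacity j S (not_le.1 hS)]
  refine h1.trans ?_
  simp only [mul_add, sum_add_distrib]
  refine add_le_add ?_ (sum_le_sum fun j _ => ?_)
  · have : ∑ j, ∑ S, x j S * ∑ i ∈ S, y i =
        ∑ i, (∑ j, ∑ S ∈ univ.filter (fun S : Finset N => i ∈ S), x j S) * y i := by
      simp only [sum_mul, mul_sum]
      rw [sum_comm (s := (univ : Finset N))]
      refine sum_congr rfl fun j _ => ?_
      exact sum_comm' (by simp)
    rw [this]
    exact sum_le_sum fun i _ => mul_le_of_le_one_left (h.buyer_nonneg i) (hx.buyer i)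
  · rw [← sum_mul]
    exact mul_le_of_le_one_left (h.seller_nonneg j) (hx.seller j)

/-- The integral solution of the configuration LP given by an assignment. -/
def assignmentVec {N M : Type*} [Fintype N] [DecidableEq N] [DecidableEq M] (σ : N → Option M)
    (j : M) (S : Finset N) : ℝ :=
  if S = served σ j then 1 else 0

lemma isIntegralVec_assignmentVec {N M : Type*} [Fintype N] [DecidableEq N] [DecidableEq M]
    (σ : N → Option M) : IsIntegralVec (assignmentVec σ) := by
  intro j S
  unfold assignmentVec
  split_ifs
  · exact ⟨1, by simp⟩
  · exact ⟨0, by simp⟩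

section
variable {N M : Type*} [Fintype N] [Fintype M] [DecidableEq N] [DecidableEq M] {k : M → ℕ}

lemma welfare_eq_sum_bundleWelfare (t : Profile N M) (σ : N → Option M) :
    welfare t σ = ∑ j, bundleWelfare t j (served σ j) := by
  simp only [welfare, bundleWelfare, sum_sub_distrib]
  rw [sum_sum_served σ fun i j => (t.1 i).1 j]
  rfl

instance : Finite (Allocation N k) := by unfold Allocation; infer_instance

instance : Nonempty (Allocation N k) := ⟨⟨fun _ => none, fun j => by simp [served]⟩⟩

lemma welfare_none (t : Profile N M) : welfare t (fun _ => none) = 0 := by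
  simp [welfare_eq_sum_bundleWelfare, served, bundleWelfare_empty]

lemma welfare_le_optWelfare (t : Profile N M) (σ : Allocation N k) :
    welfare t σ.1 ≤ optWelfare k t :=
  le_ciSup (f := fun σ : Allocation N k => welfare t σ.1) (Set.finite_range _).bddAbove σ

/-- Approximate strong duality, from the approximate equilibrium of the auction. -/
lemma exists_dualFeasible_le_add (t : Profile N M) {δ : ℝ} (hδ : 0 < δ) :
    ∃ y z, DualFeasible k t y z ∧ ∑ i, y i + ∑ j, z j ≤ optWelfare k t + δ := by
  have hn : (0 : ℝ) < Fintype.card N + 1 := by positivity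
  obtain ⟨σ, p, hcap, hp, hnone, heq⟩ := exists_approx_equilibrium
    (localExchange_bundleWelfare t) k (div_pos hδ hn)
  -- Raising every price by `ε` costs `|N| ε < δ` in total; the `+ 1` covers the case of no buyers.
  set ε := δ / (Fintype.card N + 1) with hε
  have hε0 : 0 < ε := div_pos hδ hn
  refine ⟨fun i => p i + ε,
    fun j => bundleWelfare t j (served σ j) - ∑ i ∈ served σ j, p i,
    ⟨fun j S hS => by linarith [heq j S hS], fun i => by linarith [hp i], fun j => ?_⟩, ?_⟩
  · have := heq j ∅ (by simp)
    simpa [bundleWelfare_empty] using this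
  · have h1 := welfare_le_optWelfare t (⟨σ, hcap⟩ : Allocation N k)
    rw [sum_sub_distrib, sum_sum_served_of_none hnone, ← welfare_eq_sum_bundleWelfare,
      sum_add_distrib, sum_const, card_univ, nsmul_eq_mul]
    have h2 : ε * (Fintype.card N + 1) = δ := div_mul_cancel₀ _ hn.ne'
    simp only at h1
    linarith

lemma PrimalFeasible.primalValue_le_optWelfare {t : Profile N M} {x : M → Finset N → ℝ}
    (hx : PrimalFeasible k x) : primalValue t x ≤ optWelfare k t := by
  refine le_of_forall_pos_le_add fun δ hδ => ?_
  obtain ⟨y, z, h, hle⟩ := exists_dualFeasible_le_add (k := k) t hδ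
  exact (hx.primalValue_le h).trans hle

lemma primalFeasible_assignmentVec (σ : Allocation N k) :
    PrimalFeasible k (assignmentVec σ.1) where
  nonneg j S := by unfold assignmentVec; split_ifs <;> norm_num
  capacity j S hS := by
    refine if_neg ?_
    rintro rfl
    exact absurd (σ.2 j) (not_le.2 hS)
  seller j := by simp [assignmentVec]
  buyer i := by
    have : ∀ j, ∑ S ∈ univ.filter (fun S : Finset N => i ∈ S), assignmentVec σ.1 j S =
        if σ.1 i = some j then 1 else 0 := by
      intro j
      simp [assignmentVec, sum_ite_eq', mem_served]
    simp only [this]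
    cases σ.1 i <;> simp

lemma primalValue_assignmentVec (t : Profile N M) (σ : N → Option M) :
    primalValue t (assignmentVec σ) = welfare t σ := by
  simp [primalValue, assignmentVec, welfare_eq_sum_bundleWelfare]

lemma exists_integral_optimum (k : M → ℕ) (t : Profile N M) :
    ∃ x, PrimalFeasible k x ∧ IsIntegralVec x ∧ primalValue t x = optWelfare k t := by
  obtain ⟨σ, hσ⟩ := exists_eq_ciSup_of_finite (f := fun σ : Allocation N k => welfare t σ.1)
  exact ⟨assignmentVec σ.1, primalFeasible_assignmentVec σ, isIntegralVec_assignmentVec _,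
    (primalValue_assignmentVec t σ.1).trans hσ⟩

lemma lpOpt_eq (k : M → ℕ) (t : Profile N M) : lpOpt k t = optWelfare k t := by
  refine IsGreatest.csSup_eq ⟨?_, ?_⟩
  · obtain ⟨x, hx, -, h⟩ := exists_integral_optimum k t
    exact ⟨x, hx, h⟩
  · rintro w ⟨x, hx, rfl⟩
    exact hx.primalValue_le_optWelfare

lemma integralOpt_eq (k : M → ℕ) (t : Profile N M) : integralOpt k t = optWelfare k t := by
  refine IsGreatest.csSup_eq ⟨?_, ?_⟩
  · exact exists_integral_optimum k t
  · rintro w ⟨x, hx, -, rfl⟩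
    exact hx.primalValue_le_optWelfare

lemma isIntegralityGap_one (k : M → ℕ) : IsIntegralityGap N k 1 :=
  ⟨⟨le_rfl, fun t => by rw [lpOpt_eq, integralOpt_eq, one_mul]⟩, fun _ ha => ha.1⟩

lemma nonempty_welfareAlg (k : M → ℕ) : Nonempty (WelfareAlg N k) := by
  have : ∀ t : Profile N M, ∃ σ : Allocation N k, ∀ σ' : Allocation N k,
      welfare t σ'.1 ≤ welfare t σ.1 := fun t => Finite.exists_max _
  choose f hf using this
  exact ⟨⟨f, hf⟩⟩

lemma optWelfare_le_of_dualFeasible {t : Profile N M} {y : N → ℝ} {z : M → ℝ}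
    (h : DualFeasible k t y z) : optWelfare k t ≤ ∑ i, y i + ∑ j, z j := by
  obtain ⟨x, hx, -, hv⟩ := exists_integral_optimum k t
  exact hv ▸ hx.primalValue_le h

/-- The feasible points of value at most the optimal welfare plus one form a nonempty compact set.
The objective attains its minimum there, and approximate duality bounds this minimum. -/
lemma exists_dualFeasible_eq (k : M → ℕ) (t : Profile N M) :
    ∃ y z, DualFeasible k t y z ∧ ∑ i, y i + ∑ j, z j = optWelfare k t := by
  set K : Set ((N → ℝ) × (M → ℝ)) :=
    {w | DualFeasible k t w.1 w.2 ∧ ∑ i, w.1 i + ∑ j, w.2 j ≤ optWelfare k t + 1} with hK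
  have hcont : Continuous fun w : (N → ℝ) × (M → ℝ) => ∑ i, w.1 i + ∑ j, w.2 j := by fun_prop
  have hclosed : IsClosed K := by
    have : K = (⋂ j, ⋂ S : Finset N, ⋂ _ : S.card ≤ k j,
          {w : (N → ℝ) × (M → ℝ) | bundleWelfare t j S ≤ ∑ i ∈ S, w.1 i + w.2 j}) ∩
        (⋂ i, {w | 0 ≤ w.1 i}) ∩ (⋂ j, {w | 0 ≤ w.2 j}) ∩
        {w | ∑ i, w.1 i + ∑ j, w.2 j ≤ optWelfare k t + 1} := by
      ext w
      simp only [hK, Set.mem_ofPred_eq, Set.mem_inter_iff, Set.mem_iInter]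
      exact ⟨fun h => ⟨⟨⟨h.1.1, h.1.2⟩, h.1.3⟩, h.2⟩, fun h => ⟨⟨h.1.1.1, h.1.1.2, h.1.2⟩, h.2⟩⟩
    rw [this]
    refine (((isClosed_iInter fun j => isClosed_iInter fun S => isClosed_iInter fun _ => ?_).inter
      (isClosed_iInter fun i => ?_)).inter (isClosed_iInter fun j => ?_)).inter ?_
    · exact isClosed_le continuous_const (by fun_prop)
    · exact isClosed_le continuous_const (by fun_prop)
    · exact isClosed_le continuous_const (by fun_prop)
    · exact isClosed_le hcont continuous_const
  have hcompact : IsCompact K := by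
    refine (isCompact_Icc (a := ((0 : N → ℝ), (0 : M → ℝ)))
      (b := (fun _ => optWelfare k t + 1, fun _ => optWelfare k t + 1))).of_isClosed_subset
      hclosed ?_
    rintro ⟨y, z⟩ ⟨h, hle⟩
    have hy := sum_nonneg fun i (_ : i ∈ univ) => h.buyer_nonneg i
    have hz := sum_nonneg fun j (_ : j ∈ univ) => h.seller_nonneg j
    refine ⟨⟨h.buyer_nonneg, h.seller_nonneg⟩, fun i => ?_, fun j => ?_⟩
    · have := single_le_sum (fun i _ => h.buyer_nonneg i) (mem_univ i)
      simp only at *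
      linarith
    · have := single_le_sum (fun j _ => h.seller_nonneg j) (mem_univ j)
      simp only at *
      linarith
  obtain ⟨y₀, z₀, h₀, hle₀⟩ := exists_dualFeasible_le_add (k := k) t one_pos
  obtain ⟨⟨y, z⟩, hyz, hmin⟩ := hcompact.exists_isMinOn ⟨(y₀, z₀), h₀, hle₀⟩ hcont.continuousOn
  refine ⟨y, z, hyz.1, le_antisymm ?_ (optWelfare_le_of_dualFeasible hyz.1)⟩
  refine le_of_forall_pos_le_add fun δ hδ => ?_
  -- The slack is capped at one so that the point stays in `K`.
  obtain ⟨y', z', h', hle'⟩ := exists_dualFeasible_le_add (k := k) t (lt_min hδ one_pos)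
  refine (hmin (show (y', z') ∈ K from ⟨h', hle'.trans ?_⟩)).trans (hle'.trans ?_)
  · linarith [min_le_right δ 1]
  · linarith [min_le_left δ 1]

lemma nonempty_coreAlg (k : M → ℕ) : Nonempty (CoreAlg N k) := by
  choose y z h heq using fun t : Profile N M => exists_dualFeasible_eq k t
  exact ⟨⟨y, z, fun t => ⟨h t, fun y' z' h' =>
    (heq t).le.trans (optWelfare_le_of_dualFeasible h')⟩⟩⟩

lemma DualOptimal.sum_eq {t : Profile N M} {y : N → ℝ} {z : M → ℝ} (h : DualOptimal k t y z) :
    ∑ i, y i + ∑ j, z j = optWelfare k t := by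
  obtain ⟨y', z', h', heq⟩ := exists_dualFeasible_eq k t
  exact le_antisymm ((h.2 y' z' h').trans heq.le) (optWelfare_le_of_dualFeasible h.1)

/-- By integrality the scaling factor is `1`, except when the optimum is `0`. There the quotient is
`0 / 0 = 0`, but nonnegative duals with sum `0` vanish anyway. -/
lemma CoreAlg.y_eq_and_z_eq (C : CoreAlg N k) (t : Profile N M) :
    C.y t = C.dualY t ∧ C.z t = C.dualZ t := by
  have hsum := (C.optimal t).sum_eq
  have hy := (C.optimal t).1.buyer_nonneg
  have hz := (C.optimal t).1.seller_nonneg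
  simp only [funext_iff, CoreAlg.y, CoreAlg.z, lpOpt_eq, integralOpt_eq]
  by_cases h : optWelfare k t = 0
  · have hY := sum_nonneg fun i (_ : i ∈ univ) => hy i
    have hZ := sum_nonneg fun j (_ : j ∈ univ) => hz j
    have hY0 := (sum_eq_zero_iff_of_nonneg fun i (_ : i ∈ univ) => hy i).1 (by linarith)
    have hZ0 := (sum_eq_zero_iff_of_nonneg fun j (_ : j ∈ univ) => hz j).1 (by linarith)
    exact ⟨fun i => by simp [hY0 i (mem_univ i)], fun j => by simp [hZ0 j (mem_univ j)]⟩
  · simp [div_self h]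

/-! ### Coalitions and the core of one realization -/

/-- The assignments using only the members of a coalition. -/
abbrev CoalitionAllocation (k : M → ℕ) (A : Finset N) (B : Finset M) : Type _ :=
  {σ : Allocation N k // ∀ i j, σ.1 i = some j → i ∈ A ∧ j ∈ B}

instance (A : Finset N) (B : Finset M) : Nonempty (CoalitionAllocation k A B) :=
  ⟨⟨⟨fun _ => none, fun j => by simp [served]⟩, by simp⟩⟩

lemma coalitionWelfare_nonneg (k : M → ℕ) (t : Profile N M) (A : Finset N) (B : Finset M) :
    0 ≤ coalitionWelfare k t A B :=
  (welfare_none t).ge.trans (le_ciSup (f := fun σ : CoalitionAllocation k A B => welfare t σ.1.1)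
    (Set.finite_range _).bddAbove ⟨⟨fun _ => none, fun j => by simp [served]⟩, by simp⟩)

lemma coalitionWelfare_le_optWelfare (k : M → ℕ) (t : Profile N M) (A : Finset N)
    (B : Finset M) : coalitionWelfare k t A B ≤ optWelfare k t :=
  ciSup_le fun σ : CoalitionAllocation k A B => welfare_le_optWelfare t σ.1

lemma DualFeasible.coalitionWelfare_le {t : Profile N M} {y : N → ℝ} {z : M → ℝ}
    (h : DualFeasible k t y z) (A : Finset N) (B : Finset M) :
    coalitionWelfare k t A B ≤ ∑ i ∈ A, y i + ∑ j ∈ B, z j := by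
  refine ciSup_le fun σ : CoalitionAllocation k A B => ?_
  rw [welfare_eq_sum_bundleWelfare]
  have hB : ∑ j ∈ B, bundleWelfare t j (served σ.1.1 j) =
      ∑ j, bundleWelfare t j (served σ.1.1 j) := by
    refine sum_subset (subset_univ B) fun j _ hj => ?_
    have : served σ.1.1 j = ∅ := by
      refine eq_empty_of_forall_notMem fun i hi => hj ?_
      exact (σ.2 i j (mem_served.1 hi)).2
    rw [this, bundleWelfare_empty]
  rw [← hB]
  have h1 : ∑ j ∈ B, bundleWelfare t j (served σ.1.1 j) ≤
      ∑ j ∈ B, (∑ i ∈ served σ.1.1 j, y i + z j) :=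
    sum_le_sum fun j _ => h.cover j _ (σ.1.2 j)
  have h2 : ∑ j ∈ B, ∑ i ∈ served σ.1.1 j, y i ≤ ∑ j, ∑ i ∈ served σ.1.1 j, y i :=
    sum_le_sum_of_subset_of_nonneg (subset_univ B) fun j _ _ =>
      sum_nonneg fun i _ => h.buyer_nonneg i
  have h3 := sum_sum_served_le (σ := σ.1.1) h.buyer_nonneg (A := A) fun i j hij => (σ.2 i j hij).1
  rw [sum_add_distrib] at h1
  linarith

lemma CoreAlg.inCore (C : CoreAlg N k) (t : Profile N M) :
    (∀ i, 0 ≤ C.y t i) ∧ (∀ j, 0 ≤ C.z t j) ∧ InCore k 1 t (C.y t) (C.z t) := by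
  obtain ⟨hy, hz⟩ := C.y_eq_and_z_eq t
  have h := C.optimal t
  rw [hy, hz]
  refine ⟨h.1.buyer_nonneg, h.1.seller_nonneg, h.sum_eq, fun A B => ?_⟩
  rw [one_mul]
  exact h.1.coalitionWelfare_le A B

end

/-! ### Expectations under independent discrete priors -/

lemma HasSum.mul_of_nonneg_real {ι ι' : Type*} {f : ι → ℝ} {g : ι' → ℝ} {a b : ℝ}
    (hf : HasSum f a) (hg : HasSum g b) (hf0 : ∀ i, 0 ≤ f i) (hg0 : ∀ i, 0 ≤ g i) :
    HasSum (fun x : ι × ι' => f x.1 * g x.2) (a * b) :=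
  hf.mul hg (hf.summable.mul_of_nonneg hg.summable hf0 hg0)

/-- Induction on the number of factors, splitting off the first coordinate; nonnegativity gives the
summability of the products. -/
lemma hasSum_pi_prod_one {β : Type*} (ι : Type*) [Fintype ι] :
    ∀ g : ι → β → ℝ, (∀ i b, 0 ≤ g i b) → (∀ i, HasSum (g i) 1) →
      HasSum (fun f : ι → β => ∏ i, g i (f i)) 1 := by
  classical
  have key : ∀ n : ℕ, ∀ g : Fin n → β → ℝ, (∀ i b, 0 ≤ g i b) → (∀ i, HasSum (g i) 1) →
      HasSum (fun f : Fin n → β => ∏ i, g i (f i)) 1 := by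
    intro n
    induction n with
    | zero => intro g _ _; simp
    | succ n ih =>
      intro g h0 h1
      have h := HasSum.mul_of_nonneg_real (h1 0) (ih (fun i => g i.succ) (fun i => h0 i.succ)
        (fun i => h1 i.succ)) (fun b => h0 0 b) (fun f => prod_nonneg fun i _ => h0 i.succ (f i))
      rw [one_mul] at h
      rw [← (Fin.consEquiv fun _ => β).hasSum_iff]
      convert h using 2 with x
      simp [Fin.prod_univ_succ, Fin.consEquiv]
  intro g h0 h1
  have e := Fintype.equivFin ι
  have h := key _ (fun j => g (e.symm j)) (fun j => h0 _) (fun j => h1 _)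
  rw [← (Equiv.arrowCongr e (Equiv.refl β)).hasSum_iff] at h
  convert h using 2 with f
  simp only [Function.comp_apply, Equiv.arrowCongr_apply, Equiv.coe_refl]
  exact (e.symm.prod_comp fun i => g i (f i)).symm

lemma PMF.hasSum_toReal {β : Type*} (p : PMF β) : HasSum (fun b => (p b).toReal) 1 := by
  have h := (ENNReal.summable_toReal p.tsum_coe_ne_top).hasSum
  rwa [← ENNReal.tsum_toReal_eq p.apply_ne_top, p.tsum_coe, ENNReal.toReal_one] at h

section
variable {N M : Type*} [Fintype N] [Fintype M] [DecidableEq N]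

lemma Prior.prob_nonneg (P : Prior N M) (t : Profile N M) : 0 ≤ P.prob t :=
  mul_nonneg (prod_nonneg fun _ _ => ENNReal.toReal_nonneg)
    (prod_nonneg fun _ _ => ENNReal.toReal_nonneg)

lemma Prior.hasSum_prob (P : Prior N M) : HasSum P.prob 1 := by
  have h := HasSum.mul_of_nonneg_real
    (hasSum_pi_prod_one N (fun i b => (P.buyer i b).toReal)
    (fun _ _ => ENNReal.toReal_nonneg) fun i => (P.buyer i).hasSum_toReal)
    (hasSum_pi_prod_one M (fun j c => (P.seller j c).toReal)
    (fun _ _ => ENNReal.toReal_nonneg) fun j => (P.seller j).hasSum_toReal)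
    (fun _ => prod_nonneg fun _ _ => ENNReal.toReal_nonneg)
    (fun _ => prod_nonneg fun _ _ => ENNReal.toReal_nonneg)
  rwa [one_mul] at h

namespace Prior.HasExp
variable {P : Prior N M} {f g : Profile N M → ℝ} {a b : ℝ}

lemma const (P : Prior N M) (c : ℝ) : P.HasExp (fun _ => c) c := by
  simpa [Prior.HasExp] using P.hasSum_prob.mul_right c

lemma add (hf : P.HasExp f a) (hg : P.HasExp g b) : P.HasExp (fun t => f t + g t) (a + b) := by
  simpa [Prior.HasExp, mul_add] using HasSum.add hf hg

lemma sub (hf : P.HasExp f a) (hg : P.HasExp g b) : P.HasExp (fun t => f t - g t) (a - b) := by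
  simpa [Prior.HasExp, mul_sub] using HasSum.sub hf hg

lemma finset_sum {ι : Type*} {s : Finset ι} {F : ι → Profile N M → ℝ} {A : ι → ℝ}
    (h : ∀ i ∈ s, P.HasExp (F i) (A i)) :
    P.HasExp (fun t => ∑ i ∈ s, F i t) (∑ i ∈ s, A i) := by
  simpa [Prior.HasExp, mul_sum] using hasSum_sum h

lemma unique (hf : P.HasExp f a) (hg : P.HasExp f b) : a = b := HasSum.unique hf hg

lemma mono (hf : P.HasExp f a) (hg : P.HasExp g b) (h : ∀ t, f t ≤ g t) : a ≤ b :=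
  hasSum_le (fun t => mul_le_mul_of_nonneg_left (h t) (P.prob_nonneg t)) hf hg

lemma of_le (hg : P.HasExp g b) (h0 : ∀ t, 0 ≤ f t) (h : ∀ t, f t ≤ g t) :
    P.HasExp f (∑' t, P.prob t * f t) :=
  (Summable.of_nonneg_of_le (fun t => mul_nonneg (P.prob_nonneg t) (h0 t))
    (fun t => mul_le_mul_of_nonneg_left (h t) (P.prob_nonneg t)) hg.summable).hasSum

end Prior.HasExp

/-! ### Properties of the mechanism -/

variable [DecidableEq M] {k : M → ℕ}

lemma WelfareAlg.welfare_eq (W : WelfareAlg N k) (t : Profile N M) :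
    welfare t (W.alloc t).1 = optWelfare k t :=
  le_antisymm (welfare_le_optWelfare t _) (ciSup_le (W.optimal t))

/-- Only the report of `i` may differ from the truth, and her price does not use her own reported
values except through the assignment. One formula thus covers truth-telling and every deviation. -/
lemma buyerUtility_vcgCoreMechanism (P : Prior N M) (W : WelfareAlg N k) (C : CoreAlg N k)
    {t r : Profile N M} {i : N} (h₁ : ∀ i', i' ≠ i → r.1 i' = t.1 i') (h₂ : r.2 = t.2) :
    (vcgCoreMechanism P W C).buyerUtility i (t.1 i) r =
      welfare t (W.alloc r).1 - (∑ i', C.meanY P i' + ∑ j, C.meanZ P j) + C.meanY P i := by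
  simp only [Mechanism.buyerUtility, vcgCoreMechanism, welfare, h₂]
  rw [← add_sum_erase univ (fun i' => (t.1 i').value _) (mem_univ i),
    ← add_sum_erase univ (fun i' => C.meanY P i') (mem_univ i),
    sum_congr (s₁ := univ.erase i) rfl fun i' hi' => by rw [h₁ i' (ne_of_mem_erase hi')]]
  ring

lemma sellerUtility_vcgCoreMechanism (P : Prior N M) (W : WelfareAlg N k) (C : CoreAlg N k)
    {t r : Profile N M} {j : M} (h₁ : r.1 = t.1) (h₂ : ∀ j', j' ≠ j → r.2 j' = t.2 j') :
    (vcgCoreMechanism P W C).sellerUtility j (t.2 j) r =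
      welfare t (W.alloc r).1 - (∑ i, C.meanY P i + ∑ j', C.meanZ P j') + C.meanZ P j := by
  simp only [Mechanism.sellerUtility, vcgCoreMechanism, welfare, h₁]
  rw [← add_sum_erase univ (fun j' => (t.2 j').1 _) (mem_univ j),
    ← add_sum_erase univ (fun j' => C.meanZ P j') (mem_univ j),
    sum_congr (s₁ := univ.erase j) rfl fun j' hj' => by rw [h₂ j' (ne_of_mem_erase hj')]]
  ring

lemma dsic_vcgCoreMechanism (P : Prior N M) (W : WelfareAlg N k) (C : CoreAlg N k) :
    (vcgCoreMechanism P W C).DSIC := by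
  refine ⟨fun t i b => ?_, fun t j c => ?_⟩
  · have h₁ := buyerUtility_vcgCoreMechanism P W C (t := t) (r := t) (i := i) (fun _ _ => rfl) rfl
    have h₂ := buyerUtility_vcgCoreMechanism P W C (t := t)
      (r := (Function.update t.1 i b, t.2)) (i := i) (fun i' hi' => by simp [hi']) rfl
    linarith [W.optimal t (W.alloc (Function.update t.1 i b, t.2))]
  · have h₁ := sellerUtility_vcgCoreMechanism P W C (t := t) (r := t) (j := j) rfl (fun _ _ => rfl)
    have h₂ := sellerUtility_vcgCoreMechanism P W C (t := t)
      (r := (t.1, Function.update t.2 j c)) (j := j) rfl (fun j' hj' => by simp [hj'])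
    linarith [W.optimal t (W.alloc (t.1, Function.update t.2 j c))]

lemma BuyerType.value_mem_Icc {M : Type*} (b : BuyerType M) (o : Option M) :
    b.value o ∈ Set.Icc (0 : ℝ) 1 := by
  cases o with
  | none => simp [BuyerType.value]
  | some j => exact b.2 j

lemma CoreAlg.hasExp_y {P : Prior N M} {e : ℝ} (hE : P.HasExp (optWelfare k) e)
    (C : CoreAlg N k) (i : N) : P.HasExp (fun t => C.y t i) (C.meanY P i) := by
  refine hE.of_le (fun t => (C.inCore t).1 i) fun t => ?_
  obtain ⟨hy, hz, hsum, -⟩ := C.inCore t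
  linarith [single_le_sum (fun i _ => hy i) (mem_univ i), sum_nonneg fun j (_ : j ∈ univ) => hz j]

lemma CoreAlg.hasExp_z {P : Prior N M} {e : ℝ} (hE : P.HasExp (optWelfare k) e)
    (C : CoreAlg N k) (j : M) : P.HasExp (fun t => C.z t j) (C.meanZ P j) := by
  refine hE.of_le (fun t => (C.inCore t).2.1 j) fun t => ?_
  obtain ⟨hy, hz, hsum, -⟩ := C.inCore t
  linarith [single_le_sum (fun j _ => hz j) (mem_univ j), sum_nonneg fun i (_ : i ∈ univ) => hy i]

lemma CoreAlg.sum_mean_eq {P : Prior N M} {e : ℝ} (hE : P.HasExp (optWelfare k) e)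
    (C : CoreAlg N k) : ∑ i, C.meanY P i + ∑ j, C.meanZ P j = e := by
  have h := (Prior.HasExp.finset_sum fun i (_ : i ∈ univ) => C.hasExp_y hE i).add
    (Prior.HasExp.finset_sum fun j (_ : j ∈ univ) => C.hasExp_z hE j)
  simp only [fun t => (C.inCore t).2.2.1] at h
  exact h.unique hE

lemma hasExp_buyerUtility {P : Prior N M} {e : ℝ} (hE : P.HasExp (optWelfare k) e)
    (C : CoreAlg N k) (W : WelfareAlg N k) (i : N) :
    P.HasExp (fun t => (vcgCoreMechanism P W C).buyerUtility i (t.1 i) t) (C.meanY P i) := by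
  have h := (hE.sub (.const P e)).add (.const P (C.meanY P i))
  rw [sub_self, zero_add] at h
  convert h using 2 with t
  rw [buyerUtility_vcgCoreMechanism P W C (fun _ _ => rfl) rfl, W.welfare_eq, C.sum_mean_eq hE]

lemma hasExp_sellerUtility {P : Prior N M} {e : ℝ} (hE : P.HasExp (optWelfare k) e)
    (C : CoreAlg N k) (W : WelfareAlg N k) (j : M) :
    P.HasExp (fun t => (vcgCoreMechanism P W C).sellerUtility j (t.2 j) t) (C.meanZ P j) := by
  have h := (hE.sub (.const P e)).add (.const P (C.meanZ P j))
  rw [sub_self, zero_add] at h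
  convert h using 2 with t
  rw [sellerUtility_vcgCoreMechanism P W C rfl (fun _ _ => rfl), W.welfare_eq, C.sum_mean_eq hE]

lemma exAnteBB_vcgCoreMechanism {P : Prior N M} {e : ℝ} (hE : P.HasExp (optWelfare k) e)
    (C : CoreAlg N k) (W : WelfareAlg N k) : (vcgCoreMechanism P W C).ExAnteBB P := by
  -- Costs need not be bounded. Values lie in `[0, 1]`, so they have expectations, and prices and
  -- wages are expressed through values, welfare and utilities.
  have hV : P.HasExp (fun t => ∑ i, (t.1 i).value ((W.alloc t).1 i))
      (∑ i, ∑' t, P.prob t * (t.1 i).value ((W.alloc t).1 i)) :=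
    .finset_sum fun i _ => (Prior.HasExp.const P 1).of_le
      (fun t => ((t.1 i).value_mem_Icc _).1) (fun t => ((t.1 i).value_mem_Icc _).2)
  set v := ∑ i, ∑' t, P.prob t * (t.1 i).value ((W.alloc t).1 i)
  have hB := Prior.HasExp.finset_sum fun i (_ : i ∈ univ) => hasExp_buyerUtility hE C W i
  have hS := Prior.HasExp.finset_sum fun j (_ : j ∈ univ) => hasExp_sellerUtility hE C W j
  refine ⟨v - ∑ i, C.meanY P i, ?_, ?_⟩
  · convert hV.sub hB using 2 with t
    rw [← sum_sub_distrib]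
    exact sum_congr rfl fun i _ => (sub_sub_cancel _ _).symm
  -- Values minus welfare are the total costs; adding the sellers' utilities gives the wages.
  · have h := (hV.sub hE).add hS
    have he : v - e + ∑ j, C.meanZ P j = v - ∑ i, C.meanY P i := by
      linarith [C.sum_mean_eq hE]
    rw [he] at h
    convert h using 2 with t
    simp only [← W.welfare_eq, welfare, Mechanism.sellerUtility, sum_sub_distrib]
    simp [vcgCoreMechanism]

lemma exAnteIR_vcgCoreMechanism {P : Prior N M} {e : ℝ} (hE : P.HasExp (optWelfare k) e)
    (C : CoreAlg N k) (W : WelfareAlg N k) : (vcgCoreMechanism P W C).ExAnteIR P :=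
  ⟨fun i => ⟨_, (Prior.HasExp.const P 0).mono (C.hasExp_y hE i) fun t => (C.inCore t).1 i,
      hasExp_buyerUtility hE C W i⟩,
    fun j => ⟨_, (Prior.HasExp.const P 0).mono (C.hasExp_z hE j) fun t => (C.inCore t).2.1 j,
      hasExp_sellerUtility hE C W j⟩⟩

lemma exAnteInCore_vcgCoreMechanism {P : Prior N M} {e : ℝ} (hE : P.HasExp (optWelfare k) e)
    (C : CoreAlg N k) (W : WelfareAlg N k) : (vcgCoreMechanism P W C).ExAnteInCore P 1 := by
  refine ⟨C.meanY P, C.meanZ P, hasExp_buyerUtility hE C W, hasExp_sellerUtility hE C W, ?_,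
    fun A B => ?_⟩
  · rw [C.sum_mean_eq hE]
    convert hE using 2 with t
    exact W.welfare_eq t
  -- Coalition welfare lies between `0` and the optimal welfare, so its expectation exists.
  · have h := hE.of_le (fun t => coalitionWelfare_nonneg k t A B)
      (fun t => coalitionWelfare_le_optWelfare k t A B)
    refine ⟨_, h, ?_⟩
    rw [one_mul]
    refine h.mono ((Prior.HasExp.finset_sum fun i _ => C.hasExp_y hE i).add
      (Prior.HasExp.finset_sum fun j _ => C.hasExp_z hE j)) fun t => ?_
    simpa using (C.inCore t).2.2.2 A B

end

theorem corollary3 {N M : Type*} [Fintype N] [Fintype M] [DecidableEq N] [DecidableEq M]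
    (k : M → ℕ) :
    (∀ t : Profile N M, ConfigLPIntegral k t) ∧
    IsIntegralityGap N k 1 ∧
    Nonempty (WelfareAlg N k) ∧
    Nonempty (CoreAlg N k) ∧
    (∀ (C : CoreAlg N k) (t : Profile N M),
      (∀ i, 0 ≤ C.y t i) ∧ (∀ j, 0 ≤ C.z t j) ∧ InCore k 1 t (C.y t) (C.z t)) ∧
    ∀ (P : Prior N M), Summable (fun t => P.prob t * optWelfare k t) →
      ∀ (W : WelfareAlg N k) (C : CoreAlg N k),
        (vcgCoreMechanism P W C).Efficient ∧
        (vcgCoreMechanism P W C).ExAnteBB P ∧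
        (vcgCoreMechanism P W C).DSIC ∧
        (vcgCoreMechanism P W C).ExAnteIR P ∧
        (vcgCoreMechanism P W C).ExAnteInCore P 1 := by
  refine ⟨fun t => ?_, isIntegralityGap_one k, nonempty_welfareAlg k, nonempty_coreAlg k,
    fun C t => C.inCore t, fun P hP W C => ?_⟩
  · obtain ⟨x, hx, hint, heq⟩ := exists_integral_optimum k t
    exact ⟨x, hx, hint, fun x' hx' => heq ▸ hx'.primalValue_le_optWelfare⟩
  · have hE : P.HasExp (optWelfare k) _ := hP.hasSum
    exact ⟨W.optimal, exAnteBB_vcgCoreMechanism hE C W, dsic_vcgCoreMechanism P W C,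
      exAnteIR_vcgCoreMechanism hE C W, exAnteInCore_vcgCoreMechanism hE C W⟩
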